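/- Conventions. For $f\in L^1(\mathbb R^3)$ put $\hat f(\xi)=\int f(x)e^{-2\pi i\langle \xi,x\rangle}\,dx$, extended to $L^2(\mathbb R^3)$ as usual. For $\beta\ge 0$, $H^\beta(\mathbb R^3)$ is the space of $f\in L^2(\mathbb R^3)$ with $\int(1+|\xi|^2)^\beta|\hat f(\xi)|^2\,d\xi<\infty$. For $\delta,\gamma>0$, a function $\psi\in L^2(\mathbb R^3)$ is called $(\delta,\gamma)$-feasible if there are constants $C>0$ and $q\ge q'>0$, $q\ge r>0$, $q\ge s>0$ such that $$|\hat\psi(\xi)|\le C\,\min\{1,|q\xi_1|^{\delta}\}\,\min\{1,|q'\xi_1|^{-\gamma}\}\,\min\{1,|r\xi_2|^{-\gamma}\}\,\min\{1,|s\xi_3|^{-\gamma}\}$$ for (almost) all $\xi\in\mathbb R^3$. Fix $\alpha\in(1,2]$ and $c=(c_1,c_2)$ with $c_1,c_2>0$. Let $A_{2^j}=\mathrm{diag}(2^{j\alpha/2},2^{j/2},2^{j/2})$, $M_c=\mathrm{diag}(c_1,c_2,c_2)$, and $$S_k=\begin{pmatrix}1&k_1&k_2\\0&1&0\\0&0&1\end{pmatrix}\quad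 (k=(k_1,k_2)\in\mathbb Z^2).$$ Let $\Lambda$ be the set of triples $\lambda=(j,k,m)$ with $j\in\mathbb N_0$, $m\in\mathbb Z^3$, $k\in\mathbb Z^2$ and $|k_1|,|k_2|\le\lceil 2^{j(\alpha-1)/2}\rceil$. For $\lambda\in\Lambda$ let $$\psi_\lambda(x)=2^{j(\alpha+2)/4}\,\psi(S_kA_{2^j}x-M_cm).$$ For $g\in L^2(\mathbb R^3)$ and $n\ge1$, let $|c(g)^*_n|$ be the modulus of the $n$th largest (in modulus, counted with multiplicity) of the shearlet coefficients $\langle g,\psi_\lambda\rangle$, $\lambda\in\Lambda$; that is, the non-increasing rearrangement of $(|\langle g,\psi_\lambda\rangle|)_{\lambda\in\Lambda}$. Proposition. Let $\beta\ge0$, and let $g\in H^\beta(\mathbb R^3)$ with $\operatorname{supp} g\subset[0,1]^3$. Suppose that $\psi\in L^2(\mathbb R^3)$ is compactly supported and $(\delta,\gamma)$-feasible with $\delta>2\gamma+\beta$ and $\gamma>3$. Then there is a constant $C$ such that $$\sum_{n>N}|c(g)^*_n|^2\le C\,N^{-2\beta/3}\qquad\text{for all integers } N\ge1 .$$ -/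

import Mathlib

open MeasureTheory FourierTransform
open scoped ENNReal Matrix

noncomputable section

/-- Euclidean space `ℝ³`. -/
abbrev R3 : Type := EuclideanSpace ℝ (Fin 3)

/-- The complex Hilbert space `L²(ℝ³)`. -/
abbrev L2R3 : Type := Lp ℂ 2 (volume : Measure R3)

/-- `f` vanishes almost everywhere outside `K`; for closed `K` this says that the (essential) support
of `f` is contained in `K`. -/
def SupportedIn (f : L2R3) (K : Set R3) : Prop :=
  ∀ᵐ x ∂(volume : Measure R3), x ∉ K → f x = 0

/-- `f ∈ L²(ℝ³)` is compactly supported. -/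
def CompactlySupported (f : L2R3) : Prop :=
  ∃ K : Set R3, IsCompact K ∧ SupportedIn f K

/-- The unit cube `[0,1]³`. -/
def unitCube : Set R3 := {x | ∀ i, x i ∈ Set.Icc (0 : ℝ) 1}

/-- `g ∈ L²(ℝ³)` belongs to `H^β(ℝ³)`, i.e. `∫ (1 + |ξ|²)^β |ĝ(ξ)|² dξ < ∞`, where
`ĝ(ξ) = ∫ g(x) e^{-2πi⟨ξ,x⟩} dx`. -/
def InSobolev (β : ℝ) (g : L2R3) : Prop :=
  TemperedDistribution.MemSobolev β 2 (Lp.toTemperedDistribution g)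

/-- `(δ, γ)`-feasible shearlets. The Fourier transform is the Plancherel transform of `L²(ℝ³)`, an
almost everywhere class, so the bound is required almost everywhere. In particular the value that
the real power takes at base `0` with a negative exponent plays no role. -/
def IsFeasible (δ γ : ℝ) (ψ : L2R3) : Prop :=
  ∃ C q q' r s : ℝ, 0 < q' ∧ q' ≤ q ∧ 0 < r ∧ r ≤ q ∧ 0 < s ∧ s ≤ q ∧
    ∀ᵐ ξ ∂(volume : Measure R3),
      ‖(𝓕 ψ : L2R3) ξ‖ ≤ C *
        (min 1 (|q * ξ 0| ^ δ) * min 1 (|q' * ξ 0| ^ (-γ)) *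
          min 1 (|r * ξ 1| ^ (-γ)) * min 1 (|s * ξ 2| ^ (-γ)))

/-- The scaling matrix `A_{2^j} = diag(2^{jα/2}, 2^{j/2}, 2^{j/2})`. -/
def scalingMatrix (α : ℝ) (j : ℕ) : Matrix (Fin 3) (Fin 3) ℝ :=
  !![(2 : ℝ) ^ (j * α / 2), 0, 0;
     0, (2 : ℝ) ^ ((j : ℝ) / 2), 0;
     0, 0, (2 : ℝ) ^ ((j : ℝ) / 2)]

/-- The shear matrix `S_k`, `k = (k₁, k₂) ∈ ℤ²`. -/
def shearMatrix (k : ℤ × ℤ) : Matrix (Fin 3) (Fin 3) ℝ :=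
  !![1, (k.1 : ℝ), (k.2 : ℝ);
     0, 1, 0;
     0, 0, 1]

/-- The matrix `M_c = diag(c₁, c₂, c₂)` generating the translation lattice `M_c ℤ³`. -/
def latticeMatrix (c : ℝ × ℝ) : Matrix (Fin 3) (Fin 3) ℝ :=
  !![c.1, 0, 0;
     0, c.2, 0;
     0, 0, c.2]

/-- The lattice point `M_c m`, `m ∈ ℤ³`. -/
def latticePoint (c : ℝ × ℝ) (m : Fin 3 → ℤ) : R3 :=
  WithLp.toLp 2 (latticeMatrix c *ᵥ fun i => (m i : ℝ))

/-- The index set `Λ` of the shearlet system: the triples `(j, k, m)` with `j ≥ 0`, `k ∈ ℤ²`,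
`m ∈ ℤ³` and `|k₁|, |k₂| ≤ ⌈2^{j(α-1)/2}⌉`. -/
def ShearletIndex (α : ℝ) : Type :=
  {l : ℕ × (ℤ × ℤ) × (Fin 3 → ℤ) //
    |l.2.1.1| ≤ ⌈(2 : ℝ) ^ (l.1 * (α - 1) / 2)⌉ ∧ |l.2.1.2| ≤ ⌈(2 : ℝ) ^ (l.1 * (α - 1) / 2)⌉}

/-- The shearlet `ψ_{j,k,m}(x) = 2^{j(α+2)/4} ψ(S_k A_{2^j} x - M_c m)`. -/
def shearlet (α : ℝ) (c : ℝ × ℝ) (ψ : R3 → ℂ) (j : ℕ) (k : ℤ × ℤ) (m : Fin 3 → ℤ) (x : R3) : ℂ :=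
  (((2 : ℝ) ^ (j * (α + 2) / 4) : ℝ) : ℂ) *
    ψ (WithLp.toLp 2 ((shearMatrix k * scalingMatrix α j) *ᵥ x.ofLp) - latticePoint c m)

/-- The shearlet coefficients `⟨g, ψ_λ⟩ = ∫ g(x) conj(ψ_λ(x)) dx`, `λ ∈ Λ`. -/
def shearletCoeff (α : ℝ) (c : ℝ × ℝ) (ψ g : L2R3) (l : ShearletIndex α) : ℂ :=
  ∫ x : R3, g x * (starRingEnd ℂ) (shearlet α c ψ l.1.1 l.1.2.1 l.1.2.2 x)

/-- `sortedAbs a n = |a*_n|`, `n ≥ 1`: the modulus of the `n`-th largest (in modulus) term of the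
family `a`, with multiplicity, i.e. the least `t` such that fewer than `n` of the terms have modulus
greater than `t`. -/
def sortedAbs {ι : Type*} (a : ι → ℂ) (n : ℕ) : ℝ≥0∞ :=
  sInf {t : ℝ≥0∞ | {i | t < ‖a i‖ₑ}.encard < n}

end

/-! Two facts combine: the weighted sum of 2^{jαβ} |⟨g, ψ_λ⟩|² is finite
(`tsum_weighted_shearlet_sq_ne_top`), and only O(2^{3αJ/2}) coefficients of scale below J are
nonzero (`exists_finset_card_le_shearletCoeff_eq_zero`). Choosing J with 2^{3αJ/2} comparable to N
and keeping exactly those coefficients leaves an error O(2^{-Jαβ}) = O(N^{-2β/3}), and the sorted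
tail is no larger than the error of any N-term selection (`tsum_sortedAbs_sq_le`).

For the weighted sum, write ĝ = (1+|ξ|²)^{-β/2} h with h ∈ L². Parseval and the substitution ξ =
(S_k A_{2^j})ᵀ η turn the coefficients at fixed j, k into Fourier coefficients of F(η) = ĝ(ξ) conj
ψ̂(η). Since |ξ| ≥ |ξ₁| = 2^{jα/2}|η₁|, the Sobolev factor yields 2^{-jαβ/2}|η₁|^{-β}. Feasibility
gives |ψ̂(η)| ≤ C|η₁|^β W(η), with W the `shearletWeight`, and so compensates the singularity. A
weighted Bessel inequality (`exists_tsum_enorm_fourierCoeff_sq_le`) bounds the sum over m by ∫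
|h(ξ)|² W(η) dξ, and the sum of W(η) over all j and k is bounded uniformly in ξ with ξ₁ ≠ 0
(`tsum_shearletWeight_le`).

The count uses compact supports: at scale j there are O(2^{j(α-1)}) shears and, for each, O(2^{jα/2}
· 2^j) translates that meet the unit cube. -/

/-! ### The Plancherel transform and the Sobolev density -/

/-- On `L¹ ∩ L²` the Plancherel transform is given by the Fourier integral. -/
theorem fourier_Lp_two_ae_eq_integral (f : L2R3) (hf : Integrable f) :
    ∀ᵐ ξ, (𝓕 f : L2R3) ξ = 𝓕 (f : R3 → ℂ) ξ := by
  have hcont : Continuous (𝓕 (f : R3 → ℂ)) :=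
    VectorFourier.fourierIntegral_continuous Real.continuous_fourierChar
      (by exact continuous_inner) hf
  have key : ∀ᵐ ξ, ((𝓕 f : L2R3) ξ - 𝓕 (f : R3 → ℂ) ξ) = 0 := by
    apply ae_eq_zero_of_integral_contDiff_smul_eq_zero
    · exact ((Lp.memLp _).locallyIntegrable (by norm_num)).sub hcont.locallyIntegrable
    · intro φ hφ hc
      have hg₁ : HasCompactSupport (Complex.ofRealCLM ∘ φ) := hc.comp_left rfl
      have hg₂ : ContDiff ℝ _ (Complex.ofRealCLM ∘ φ) := Complex.ofRealCLM.contDiff.comp hφ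
      set u := hg₁.toSchwartzMap hg₂ with hu
      -- Both transforms are moved onto the test function: the Plancherel transform by its
      -- compatibility with tempered distributions, the Fourier integral by Fubini.
      have h1 := congrArg (fun T => T u) (Lp.fourier_toTemperedDistribution_eq f)
      simp only [TemperedDistribution.fourier_apply, Lp.toTemperedDistribution_apply] at h1
      have h2 := VectorFourier.integral_fourierIntegral_smul_eq_flip (μ := (volume : Measure R3))
        (ν := (volume : Measure R3)) (L := innerₗ R3) (f := u) (g := f)
        Real.continuous_fourierChar (by exact continuous_inner) u.integrable hf
      rw [flip_innerₗ] at h2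
      have e1 : ∀ x, φ x • ((𝓕 f : L2R3) x - 𝓕 (f : R3 → ℂ) x) =
          u x • (𝓕 f : L2R3) x - u x • 𝓕 (f : R3 → ℂ) x := by
        intro x; simp [hu, mul_sub]
      simp_rw [e1]
      rw [integral_sub, ← h1, sub_eq_zero]
      · exact h2
      · have := (u.memLp 2 volume).integrable_mul (Lp.memLp (𝓕 f : L2R3))
        exact this
      · apply Continuous.integrable_of_hasCompactSupport (u.continuous.mul hcont)
        exact hg₁.mul_right
  filter_upwards [key] with ξ h using sub_eq_zero.1 h

/-- The Sobolev condition supplies h as a distributional product. Multiplying by the inverse weight,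
bounded because β ≥ 0, stays within L², and injectivity of L² into the tempered distributions gives
equality almost everywhere. -/
theorem InSobolev.exists_fourier_eq {β : ℝ} (hβ : 0 ≤ β) {g : L2R3} (hg : InSobolev β g) :
    ∃ h : L2R3, ∀ᵐ ξ, (𝓕 g : L2R3) ξ = (((1 + ‖ξ‖ ^ 2) ^ (-(β / 2)) : ℝ) : ℂ) * h ξ := by
  obtain ⟨h, hh⟩ := TemperedDistribution.memSobolev_iff_exists_smulLeftCLM_fourier.1 hg
  refine ⟨h, ?_⟩
  set w : R3 → ℂ := fun ξ => (((1 + ‖ξ‖ ^ 2) ^ (-(β / 2)) : ℝ) : ℂ) with hw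
  have hwt : w.HasTemperateGrowth := by rw [hw]; fun_prop
  have hwm : MemLp w ∞ (volume : Measure R3) := by
    refine memLp_top_of_bound hwt.1.continuous.aestronglyMeasurable 1 (ae_of_all _ fun ξ => ?_)
    rw [hw, Complex.norm_real, Real.norm_of_nonneg (by positivity)]
    exact Real.rpow_le_one_of_one_le_of_nonpos (by simp) (by linarith)
  have e := Lp.toTemperedDistribution_smul_eq (r := 2) hwt hwm h
  rw [← hh, TemperedDistribution.smulLeftCLM_smulLeftCLM_apply (by fun_prop) hwt] at e
  have e2 : ((fun x : R3 ↦ (((1 + ‖x‖ ^ 2) ^ (β / 2) : ℝ) : ℂ)) * w) = fun _ => 1 := by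
    ext ξ
    rw [Pi.mul_apply, hw, ← Complex.ofReal_mul, ← Real.rpow_add (by positivity)]
    simp
  rw [e2, TemperedDistribution.smulLeftCLM_const, one_smul,
    Lp.fourier_toTemperedDistribution_eq] at e
  have inj := LinearMap.ker_eq_bot.1
    (Lp.ker_toTemperedDistributionCLM_eq_bot (μ := (volume : Measure R3)) (F := ℂ) (p := 2))
  have e3 := inj e
  filter_upwards [Lp.coeFn_lpSMul (r := 2) (hwm.toLp w) h, hwm.coeFn_toLp] with ξ h1 h2
  rw [← e3, h1, Pi.smul_apply', h2, smul_eq_mul]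

/-! ### Affine changes of variables and Parseval's formula -/

theorem map_mulVec_sub {M : Matrix (Fin 3) (Fin 3) ℝ} (hM : M.det ≠ 0) (v : R3) :
    Measure.map (fun x : R3 => (WithLp.toLp 2 (M *ᵥ x.ofLp) - v : R3)) volume =
      ENNReal.ofReal |M.det|⁻¹ • (volume : Measure R3) := by
  have hd : LinearMap.det (Matrix.toLpLin 2 2 M) ≠ 0 := by rwa [LinearMap.det_toLpLin]
  have hm := Measure.map_linearMap_addHaar_eq_smul_addHaar (volume : Measure R3) hd
  rw [LinearMap.det_toLpLin, abs_inv] at hm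
  have h := Measure.map_map (μ := (volume : Measure R3)) (measurable_sub_const v)
    (Matrix.toLpLin 2 2 M).continuous_of_finiteDimensional.measurable
  rw [hm, Measure.map_smul, map_sub_right_eq_self] at h
  exact h.symm

theorem continuous_mulVec_sub (M : Matrix (Fin 3) (Fin 3) ℝ) (v : R3) :
    Continuous (fun x : R3 => (WithLp.toLp 2 (M *ᵥ x.ofLp) - v : R3)) :=
  (Matrix.toLpLin 2 2 M).continuous_of_finiteDimensional.sub continuous_const

theorem measurableEmbedding_mulVec_sub {M : Matrix (Fin 3) (Fin 3) ℝ} (hM : M.det ≠ 0) (v : R3) :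
    MeasurableEmbedding (fun x : R3 => (WithLp.toLp 2 (M *ᵥ x.ofLp) - v : R3)) := by
  refine (continuous_mulVec_sub M v).measurableEmbedding fun x y h => ?_
  have h1 := congrArg WithLp.ofLp (sub_left_inj.1 h)
  exact WithLp.ofLp_injective 2 (Matrix.mulVec_injective_iff_isUnit.2
    ((Matrix.isUnit_iff_isUnit_det M).2 hM.isUnit) h1)

theorem integral_comp_mulVec_sub {M : Matrix (Fin 3) (Fin 3) ℝ} (hM : M.det ≠ 0) (v : R3)
    {E : Type*} [NormedAddCommGroup E] [NormedSpace ℝ E] (f : R3 → E) :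
    ∫ x : R3, f (WithLp.toLp 2 (M *ᵥ x.ofLp) - v) = |M.det|⁻¹ • ∫ x, f x := by
  have h := (measurableEmbedding_mulVec_sub hM v).integral_map (μ := volume) f
  rw [map_mulVec_sub hM, integral_smul_measure, ENNReal.toReal_ofReal (by positivity)] at h
  exact h.symm

theorem lintegral_comp_mulVec {M : Matrix (Fin 3) (Fin 3) ℝ} (hM : M.det ≠ 0)
    (f : R3 → ℝ≥0∞) :
    ∫⁻ x : R3, f (WithLp.toLp 2 (M *ᵥ x.ofLp)) = ENNReal.ofReal |M.det|⁻¹ * ∫⁻ x, f x := by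
  have h := (measurableEmbedding_mulVec_sub hM 0).lintegral_map (μ := volume) f
  rw [map_mulVec_sub hM, lintegral_smul_measure] at h
  simpa using h.symm

theorem quasiMeasurePreserving_mulVec_sub {M : Matrix (Fin 3) (Fin 3) ℝ} (hM : M.det ≠ 0)
    (v : R3) : Measure.QuasiMeasurePreserving
      (fun x : R3 => (WithLp.toLp 2 (M *ᵥ x.ofLp) - v : R3)) volume volume :=
  ⟨(continuous_mulVec_sub M v).measurable, by
    rw [map_mulVec_sub hM]; exact Measure.smul_absolutelyContinuous⟩

theorem memLp_comp_mulVec_sub {M : Matrix (Fin 3) (Fin 3) ℝ} (hM : M.det ≠ 0) (v : R3)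
    {f : R3 → ℂ} {p : ℝ≥0∞} (hf : MemLp f p) :
    MemLp (fun x : R3 => f (WithLp.toLp 2 (M *ᵥ x.ofLp) - v)) p := by
  refine MemLp.comp_of_map (f := fun x : R3 => (WithLp.toLp 2 (M *ᵥ x.ofLp) - v : R3)) ?_
    (continuous_mulVec_sub M v).aemeasurable
  rw [map_mulVec_sub hM]
  exact hf.smul_measure ENNReal.ofReal_ne_top

theorem inner_mulVec_eq (M : Matrix (Fin 3) (Fin 3) ℝ) (x η : R3) :
    inner ℝ (WithLp.toLp 2 (M *ᵥ x.ofLp) : R3) η = inner ℝ x (WithLp.toLp 2 (Mᵀ *ᵥ η.ofLp)) := by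
  simp [PiLp.inner_apply, Matrix.mulVec, dotProduct, Fin.sum_univ_three]
  ring

/-- The Fourier integral of `x ↦ f (M x - v)` at the frequency `Mᵀ η`. -/
theorem fourier_comp_mulVec_sub {M : Matrix (Fin 3) (Fin 3) ℝ} (hM : M.det ≠ 0) (v : R3)
    (f : R3 → ℂ) (η : R3) :
    𝓕 (fun x : R3 => f (WithLp.toLp 2 (M *ᵥ x.ofLp) - v)) (WithLp.toLp 2 (Mᵀ *ᵥ η.ofLp)) =
      ((|M.det|⁻¹ : ℝ) : ℂ) * (Real.fourierChar (-(inner ℝ v η)) : ℂ) * 𝓕 f η := by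
  rw [Real.fourier_eq, Real.fourier_eq]
  have h1 : ∀ x : R3, Real.fourierChar (-inner ℝ x (WithLp.toLp 2 (Mᵀ *ᵥ η.ofLp) : R3)) •
      f (WithLp.toLp 2 (M *ᵥ x.ofLp) - v) =
      (fun y : R3 => (Real.fourierChar (-(inner ℝ v η)) : ℂ) *
        (Real.fourierChar (-(inner ℝ y η)) • f y)) (WithLp.toLp 2 (M *ᵥ x.ofLp) - v) := by
    intro x
    simp only [Circle.smul_def, smul_eq_mul]
    rw [← mul_assoc, ← Circle.coe_mul, ← AddChar.map_add_eq_mul, ← inner_mulVec_eq,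
      inner_sub_left]
    congr 4
    ring
  simp_rw [h1]
  rw [integral_comp_mulVec_sub hM v (fun y : R3 => (Real.fourierChar (-(inner ℝ v η)) : ℂ) *
        (Real.fourierChar (-(inner ℝ y η)) • f y)), integral_const_mul, Complex.real_smul, mul_assoc]

/-- Parseval's formula for the coefficients of `g` against dilated translates of `ψ`. -/
theorem integral_mul_conj_comp_mulVec_sub {M : Matrix (Fin 3) (Fin 3) ℝ} (hM : M.det ≠ 0) (v : R3)
    (g ψ : L2R3) (hψ : Integrable ψ) :
    ∫ x : R3, g x * (starRingEnd ℂ) (ψ (WithLp.toLp 2 (M *ᵥ x.ofLp) - v)) =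
      ∫ η : R3, (𝓕 g : L2R3) (WithLp.toLp 2 (Mᵀ *ᵥ η.ofLp)) *
        (starRingEnd ℂ) ((𝓕 ψ : L2R3) η) * (Real.fourierChar (inner ℝ v η) : ℂ) := by
  have hMt : Mᵀ.det ≠ 0 := by rwa [Matrix.det_transpose]
  set f : R3 → ℂ := fun x => ψ (WithLp.toLp 2 (M *ᵥ x.ofLp) - v) with hf
  have hf2 : MemLp f 2 := memLp_comp_mulVec_sub hM v (Lp.memLp ψ)
  have hf1 : Integrable f := memLp_one_iff_integrable.1
    (memLp_comp_mulVec_sub hM v (memLp_one_iff_integrable.2 hψ))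
  set h : L2R3 := hf2.toLp f with hh
  have hae : h =ᵐ[volume] f := hf2.coeFn_toLp
  have h1 : ∫ x : R3, g x * (starRingEnd ℂ) (f x) =
      ∫ ξ : R3, (𝓕 g : L2R3) ξ * (starRingEnd ℂ) ((𝓕 h : L2R3) ξ) := by
    have := Lp.inner_fourier_eq h g
    rw [L2.inner_def, L2.inner_def] at this
    simp only [RCLike.inner_apply] at this
    rw [this]
    refine integral_congr_ae ?_
    filter_upwards [hae] with x hx
    rw [hx]
  rw [h1]
  have h2 := fourier_Lp_two_ae_eq_integral h (hf1.congr hae.symm)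
  have h3 := fourier_Lp_two_ae_eq_integral ψ hψ
  have h4 := integral_comp_mulVec_sub hMt 0
    (fun ξ => (𝓕 g : L2R3) ξ * (starRingEnd ℂ) ((𝓕 h : L2R3) ξ))
  simp only [sub_zero, Matrix.det_transpose] at h4
  have h5 : ∫ ξ : R3, (𝓕 g : L2R3) ξ * (starRingEnd ℂ) ((𝓕 h : L2R3) ξ) = |M.det| •
      ∫ x : R3, (𝓕 g : L2R3) (WithLp.toLp 2 (Mᵀ *ᵥ x.ofLp)) *
        (starRingEnd ℂ) ((𝓕 h : L2R3) (WithLp.toLp 2 (Mᵀ *ᵥ x.ofLp))) := by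
    rw [h4, smul_smul, mul_inv_cancel₀ (abs_ne_zero.2 hM), one_smul]
  rw [h5, ← integral_smul]
  refine integral_congr_ae ?_
  have h6 := (quasiMeasurePreserving_mulVec_sub hMt 0).ae h2
  simp only [sub_zero] at h6
  filter_upwards [h6, h3] with η hη hη'
  rw [hη, hη', Real.fourier_congr_ae hae, hf, fourier_comp_mulVec_sub hM v]
  simp only [map_mul, Complex.conj_ofReal, Complex.real_smul]
  rw [AddChar.map_neg_eq_inv, Circle.coe_inv_eq_conj, Complex.conj_conj]
  -- The Jacobian of ξ = Mᵀη cancels the determinant produced by the transform of the dilated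
  -- function.
  have : (((|M.det|)⁻¹ : ℝ) : ℂ) * ((|M.det| : ℝ) : ℂ) = 1 := by
    rw [← Complex.ofReal_mul, inv_mul_cancel₀ (abs_ne_zero.2 hM), Complex.ofReal_one]
  linear_combination ((𝓕 g : L2R3) (WithLp.toLp 2 (Mᵀ *ᵥ η.ofLp)) *
    (Real.fourierChar (inner ℝ v η) : ℂ) * (starRingEnd ℂ) (𝓕 (ψ : R3 → ℂ) η)) * this

/-! ### Decreasing rearrangement and best N-term error -/

theorem le_encard_of_lt_sortedAbs {ι : Type*} {a : ι → ℂ} {n : ℕ} {t : ℝ≥0∞}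
    (h : t < sortedAbs a n) : (n : ℕ∞) ≤ {i | t < ‖a i‖ₑ}.encard := by
  by_contra! h'
  exact absurd (sInf_le (a := t) h') (not_le.2 h)

/-- If the n-th largest modulus exceeds t, at least n terms do. At most N of them lie in `F`, so n -
N lie outside, which confines n to an interval of the right length. -/
theorem encard_lt_sortedAbs_le {ι : Type*} (a : ι → ℂ) (F : Finset ι) {N : ℕ} (hF : F.card ≤ N)
    (t : ℝ≥0∞) :
    {n | N < n ∧ t < sortedAbs a n}.encard ≤ {i | i ∉ F ∧ t < ‖a i‖ₑ}.encard := by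
  rcases Set.finite_or_infinite {i | i ∉ F ∧ t < ‖a i‖ₑ} with hfin | hinf
  · obtain ⟨e, he⟩ := hfin.exists_encard_eq_coe
    rw [he]
    have hsub : {n | N < n ∧ t < sortedAbs a n} ⊆ ((Finset.Ioc N (N + e) : Finset ℕ) : Set ℕ) := by
      rintro n ⟨h1, h2⟩
      have h3 := le_encard_of_lt_sortedAbs h2
      have h4 : {i | t < ‖a i‖ₑ} ⊆ (F : Set ι) ∪ {i | i ∉ F ∧ t < ‖a i‖ₑ} := by
        intro i hi
        by_cases h : i ∈ F
        · exact Or.inl h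
        · exact Or.inr ⟨h, hi⟩
      have h5 := (h3.trans (Set.encard_le_encard h4)).trans (Set.encard_union_le _ _)
      rw [he, Set.encard_coe_eq_coe_finsetCard] at h5
      have h6 : n ≤ F.card + e := by exact_mod_cast h5
      simp only [Finset.coe_Ioc, Set.mem_Ioc]
      omega
    refine (Set.encard_le_encard hsub).trans ?_
    rw [Set.encard_coe_eq_coe_finsetCard]
    simp
  · rw [hinf.encard_eq]; exact le_top

theorem lintegral_layer_sq_of_ne_top {x : ℝ≥0∞} (hx : x ≠ ∞) :
    ∫⁻ t in Set.Ioi (0 : ℝ), (if ENNReal.ofReal t < x then ENNReal.ofReal (2 * t) else 0) =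
      x ^ 2 := by
  lift x to NNReal using hx
  have h1 : ∀ t ∈ Set.Ioi (0 : ℝ),
      (if ENNReal.ofReal t < (x : ℝ≥0∞) then ENNReal.ofReal (2 * t) else 0) =
      (Set.Iio (x : ℝ)).indicator (fun t => ENNReal.ofReal (2 * t)) t := by
    intro t ht
    rw [Set.indicator_apply]
    congr 1
    rw [← ENNReal.ofReal_coe_nnreal, ENNReal.ofReal_lt_ofReal_iff_of_nonneg (le_of_lt ht)]
    rfl
  rw [setLIntegral_congr_fun measurableSet_Ioi h1, lintegral_indicator measurableSet_Iio,
    Measure.restrict_restrict measurableSet_Iio, Set.inter_comm, Set.Ioi_inter_Iio,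
    ← ofReal_integral_eq_lintegral_ofReal]
  · rw [← integral_Ioc_eq_integral_Ioo, ← intervalIntegral.integral_of_le x.coe_nonneg]
    have h2 : ∫ t in (0 : ℝ)..x, 2 * t = (x : ℝ) ^ 2 := by
      rw [intervalIntegral.integral_const_mul, integral_id]; ring
    rw [h2, ← ENNReal.ofReal_coe_nnreal, ← ENNReal.ofReal_pow x.coe_nonneg]
  · exact ((continuous_const.mul continuous_id).integrableOn_Icc (a := (0 : ℝ))
      (b := x)).mono_set Set.Ioo_subset_Icc_self
  · filter_upwards [ae_restrict_mem measurableSet_Ioo] with t ht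
    have := ht.1
    show (0 : ℝ) ≤ 2 * t
    linarith

theorem lintegral_layer_sq (x : ℝ≥0∞) :
    ∫⁻ t in Set.Ioi (0 : ℝ), (if ENNReal.ofReal t < x then ENNReal.ofReal (2 * t) else 0) =
      x ^ 2 := by
  by_cases hx : x = ∞
  · subst hx
    rw [ENNReal.top_pow two_ne_zero]
    refine ENNReal.eq_top_of_forall_nnreal_le fun r => ?_
    have h1 : ((r + 1 : NNReal) : ℝ≥0∞) ^ 2 ≤
        ∫⁻ t in Set.Ioi (0 : ℝ), (if ENNReal.ofReal t < ∞ then ENNReal.ofReal (2 * t) else 0) := by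
      rw [← lintegral_layer_sq_of_ne_top (x := ((r + 1 : NNReal) : ℝ≥0∞)) ENNReal.coe_ne_top]
      refine lintegral_mono fun t => ?_
      simp only [ENNReal.ofReal_lt_top, if_true]
      split_ifs <;> simp
    refine le_trans ?_ h1
    rw [← ENNReal.coe_pow, ENNReal.coe_le_coe]
    have := r.2
    rw [← NNReal.coe_le_coe]
    push_cast
    nlinarith [r.coe_nonneg]
  · exact lintegral_layer_sq_of_ne_top hx

theorem tsum_subtype_ite_const {κ : Type*} (s : Set κ) (p : κ → Prop) [DecidablePred p]
    (y : ℝ≥0∞) :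
    ∑' i : s, (if p i then y else 0) = ({i | i ∈ s ∧ p i}.encard : ℝ≥0∞) * y := by
  rw [tsum_subtype s fun i => if p i then y else 0, ← ENNReal.tsum_set_const,
    tsum_subtype _ fun _ => y]
  refine tsum_congr fun i => ?_
  by_cases h1 : i ∈ s <;> by_cases h2 : p i <;> simp [h1, h2]

/-- The best `N`-term error is at most the error of any `N`-term selection. -/
theorem tsum_sortedAbs_sq_le {ι : Type*} [Countable ι] (a : ι → ℂ) (F : Finset ι) {N : ℕ}
    (hF : F.card ≤ N) :
    ∑' n : Set.Ioi N, sortedAbs a n ^ 2 ≤ ∑' i : {i // i ∉ F}, ‖a i‖ₑ ^ 2 := by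
  have hm : ∀ x : ℝ≥0∞, Measurable fun t : ℝ =>
      (if ENNReal.ofReal t < x then ENNReal.ofReal (2 * t) else 0) := fun x =>
    Measurable.ite (measurableSet_lt ENNReal.measurable_ofReal measurable_const)
      (by fun_prop) measurable_const
  -- The layer-cake formula reduces the comparison of square sums to one of counting functions at
  -- each level t.
  simp_rw [← lintegral_layer_sq]
  rw [← lintegral_tsum fun _ => (hm _).aemeasurable, ← lintegral_tsum fun _ => (hm _).aemeasurable]
  refine lintegral_mono fun t => ?_
  have k1 := tsum_subtype_ite_const (Set.Ioi N) (fun n => ENNReal.ofReal t < sortedAbs a n) (ENNReal.ofReal (2 * t))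
  have k2 := tsum_subtype_ite_const {i : ι | i ∉ F} (fun i => ENNReal.ofReal t < ‖a i‖ₑ) (ENNReal.ofReal (2 * t))
  refine k1.trans_le (le_trans ?_ k2.symm.le)
  gcongr
  exact encard_lt_sortedAbs_le a F hF _

/-! ### Uniform sums of the weight over shears and scales -/

/-- Telescoping: each term after the first is at most the difference of consecutive values of
1/(τ(1+τn)). -/
theorem tsum_inv_one_add_mul_sq_le {τ : ℝ} (hτ : 0 < τ) :
    ∑' n : ℕ, ENNReal.ofReal (1 / (1 + τ * n) ^ 2) ≤ ENNReal.ofReal (1 + 1 / τ) := by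
  refine ENNReal.tsum_le_of_sum_range_le fun n => ?_
  rw [← ENNReal.ofReal_sum_of_nonneg fun _ _ => by positivity]
  refine ENNReal.ofReal_le_ofReal ?_
  have h : ∀ n : ℕ, ∑ i ∈ Finset.range (n + 1), 1 / (1 + τ * (i : ℝ)) ^ 2 ≤
      1 + 1 / τ - 1 / (τ * (1 + τ * n)) := by
    intro n
    induction n with
    | zero => simp
    | succ n ih =>
      rw [Finset.sum_range_succ]
      have h1 : 1 / (1 + τ * ((n + 1 : ℕ) : ℝ)) ^ 2 ≤
          1 / (τ * (1 + τ * n)) - 1 / (τ * (1 + τ * ((n + 1 : ℕ) : ℝ))) := by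
        have e : 1 / (τ * (1 + τ * n)) - 1 / (τ * (1 + τ * ((n + 1 : ℕ) : ℝ))) =
            1 / ((1 + τ * n) * (1 + τ * ((n + 1 : ℕ) : ℝ))) := by
          have : 0 < 1 + τ * n := by positivity
          have : 0 < 1 + τ * ((n + 1 : ℕ) : ℝ) := by positivity
          field_simp
          push_cast; ring
        rw [e, sq]
        gcongr
        simp
      linarith
  have h2 := h n
  rw [Finset.sum_range_succ] at h2
  have h3 : 0 ≤ 1 / (τ * (1 + τ * n)) := by positivity
  have h4 : 0 ≤ 1 / (1 + τ * (n : ℝ)) ^ 2 := by positivity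
  linarith

theorem tsum_int_inv_one_add_abs_sub_sq_le {t : ℝ} (ht : t ≠ 0) (a : ℝ) :
    ∑' k : ℤ, ENNReal.ofReal (1 / (1 + |a - k * t|) ^ 2) ≤ ENNReal.ofReal (2 + 2 / |t|) := by
  have ht' : 0 < |t| := abs_pos.2 ht
  -- With this centre, both p + n and p - (n + 1) are at distance at least n from a/t, so each half
  -- of the sum falls under the one-sided bound.
  set p : ℤ := ⌊a / t⌋ + 1 with hp
  rw [← (Equiv.addRight p).tsum_eq]
  have hs := HasSum.of_nat_of_neg_add_one
    (f := fun k : ℤ => ENNReal.ofReal (1 / (1 + |a - ((Equiv.addRight p k : ℤ) : ℝ) * t|) ^ 2))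
    ENNReal.summable.hasSum ENNReal.summable.hasSum
  rw [hs.tsum_eq]
  have h0 : ENNReal.ofReal (2 + 2 / |t|) =
      ENNReal.ofReal (1 + 1 / |t|) + ENNReal.ofReal (1 + 1 / |t|) := by
    rw [← ENNReal.ofReal_add (by positivity) (by positivity)]
    congr 1; ring
  rw [h0]
  have h1 : (⌊a / t⌋ : ℝ) ≤ a / t := Int.floor_le _
  have h2 : a / t < (⌊a / t⌋ : ℝ) + 1 := Int.lt_floor_add_one _
  have h3 : ∀ k : ℝ, |a - k * t| = |t| * |a / t - k| := by
    intro k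
    rw [← abs_mul]; congr 1; field_simp
  refine add_le_add ?_ ?_
  · refine le_trans (ENNReal.tsum_le_tsum fun n => ENNReal.ofReal_le_ofReal ?_)
      (tsum_inv_one_add_mul_sq_le ht')
    rw [h3]
    gcongr
    rw [abs_sub_comm, Equiv.coe_addRight, hp]
    push_cast
    exact le_trans (by linarith) (le_abs_self _)
  · refine le_trans (ENNReal.tsum_le_tsum fun n => ENNReal.ofReal_le_ofReal ?_)
      (tsum_inv_one_add_mul_sq_le ht')
    rw [h3]
    gcongr
    rw [Equiv.coe_addRight, hp]
    push_cast
    exact le_trans (by linarith) (le_abs_self _)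

/-- Telescoping again: with t = ρ^j x, the increment 1/(1+ρt) - 1/(1+t) equals (1-ρ)t/((1+ρt)(1+t)),
which dominates (1-ρ)t/(1+t)². The bound is independent of x. -/
theorem tsum_geometric_div_one_add_sq_le {x ρ : ℝ} (hx : 0 ≤ x) (h0 : 0 < ρ) (h1 : ρ < 1) :
    ∑' j : ℕ, ENNReal.ofReal (ρ ^ j * x / (1 + ρ ^ j * x) ^ 2) ≤ ENNReal.ofReal (1 / (1 - ρ)) := by
  refine ENNReal.tsum_le_of_sum_range_le fun n => ?_
  rw [← ENNReal.ofReal_sum_of_nonneg fun _ _ => by positivity]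
  refine ENNReal.ofReal_le_ofReal ?_
  have hρ : 0 < 1 - ρ := by linarith
  rw [le_div_iff₀' hρ]
  have h : ∀ n : ℕ, (1 - ρ) * ∑ j ∈ Finset.range n, ρ ^ j * x / (1 + ρ ^ j * x) ^ 2 ≤
      1 / (1 + ρ ^ n * x) - 1 / (1 + x) := by
    intro n
    induction n with
    | zero => simp
    | succ n ih =>
      rw [Finset.sum_range_succ, mul_add]
      have h2 : (1 - ρ) * (ρ ^ n * x / (1 + ρ ^ n * x) ^ 2) ≤
          1 / (1 + ρ ^ (n + 1) * x) - 1 / (1 + ρ ^ n * x) := by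
        set t := ρ ^ n * x with ht
        have ht0 : 0 ≤ t := by positivity
        have e : ρ ^ (n + 1) * x = ρ * t := by rw [ht]; ring
        have e2 : 1 / (1 + ρ * t) - 1 / (1 + t) = (1 - ρ) * (t / ((1 + ρ * t) * (1 + t))) := by
          have : 0 < 1 + ρ * t := by positivity
          have : 0 < 1 + t := by positivity
          field_simp
          ring
        rw [e, e2, sq]
        gcongr
        nlinarith
      linarith
  refine (h n).trans ?_
  have h3 : 1 / (1 + ρ ^ n * x) ≤ 1 := by
    rw [div_le_one (by positivity)]
    have : 0 ≤ ρ ^ n * x := by positivity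
    linarith
  have h4 : 0 ≤ 1 / (1 + x) := by positivity
  linarith

/-- The dominating weight of a feasible shearlet on the frequency side. -/
noncomputable def shearletWeight (η : R3) : ℝ :=
  |η 0| ^ 3 / (1 + |η 0|) ^ 6 * (1 / (1 + |η 1|) ^ 2) * (1 / (1 + |η 2|) ^ 2)

theorem shearletWeight_nonneg (η : R3) : 0 ≤ shearletWeight η := by
  unfold shearletWeight; positivity

theorem continuous_shearletWeight : Continuous shearletWeight := by
  unfold shearletWeight
  have h : ∀ i : Fin 3, Continuous fun η : R3 => |η i| := fun i => by fun_prop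
  refine Continuous.mul (Continuous.mul ?_ ?_) ?_
  · exact Continuous.div (by fun_prop) (by fun_prop) fun η => by positivity
  · exact Continuous.div (by fun_prop) (by fun_prop) fun η => by positivity
  · exact Continuous.div (by fun_prop) (by fun_prop) fun η => by positivity

theorem shearletWeight_le (η : R3) :
    shearletWeight η ≤ 1 / (1 + |η 0|) ^ 2 * (1 / (1 + |η 1|) ^ 2) * (1 / (1 + |η 2|) ^ 2) := by
  refine mul_le_mul_of_nonneg_right (mul_le_mul_of_nonneg_right ?_ (by positivity)) (by positivity)
  rw [div_le_div_iff₀ (by positivity) (by positivity), one_mul]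
  have h : |η 0| ^ 3 ≤ (1 + |η 0|) ^ 4 := by
    calc |η 0| ^ 3 ≤ (1 + |η 0|) ^ 3 := by gcongr; linarith
      _ ≤ (1 + |η 0|) ^ 4 := pow_le_pow_right₀ (by linarith [abs_nonneg (η 0)]) (by norm_num)
  calc _ ≤ (1 + |η 0|) ^ 4 * (1 + |η 0|) ^ 2 := by gcongr
    _ = _ := by ring

/-- With t = ρ^j x, the two shear sums cost (2+2/|t|)² whatever their centres. The factor
|t|³/(1+|t|)⁶ absorbs the singularity and leaves 4|t|/(1+|t|)⁴, summable over geometric t. -/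
theorem tsum_shearletWeight_le {ρ : ℝ} (h0 : 0 < ρ) (h1 : ρ < 1) {x : ℝ} (hx : x ≠ 0)
    (y z : ℕ → ℝ) :
    ∑' (j : ℕ) (k : ℤ × ℤ), ENNReal.ofReal (shearletWeight
      !₂[ρ ^ j * x, y j - k.1 * (ρ ^ j * x), z j - k.2 * (ρ ^ j * x)]) ≤
      ENNReal.ofReal (4 / (1 - ρ)) := by
  have hj : ∀ j : ℕ, ∑' (k : ℤ × ℤ), ENNReal.ofReal (shearletWeight
      !₂[ρ ^ j * x, y j - k.1 * (ρ ^ j * x), z j - k.2 * (ρ ^ j * x)]) ≤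
      ENNReal.ofReal 4 * ENNReal.ofReal (ρ ^ j * |x| / (1 + ρ ^ j * |x|) ^ 2) := by
    intro j
    have ht : ρ ^ j * x ≠ 0 := by positivity
    have habs : |ρ ^ j * x| = ρ ^ j * |x| := by rw [abs_mul, abs_of_pos (by positivity)]
    set t := ρ ^ j * x with htd
    rw [← habs]
    have ht' : 0 < |t| := abs_pos.2 ht
    have e : ∀ k : ℤ × ℤ, ENNReal.ofReal (shearletWeight !₂[t, y j - k.1 * t, z j - k.2 * t]) =
        ENNReal.ofReal (|t| ^ 3 / (1 + |t|) ^ 6) *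
          (ENNReal.ofReal (1 / (1 + |y j - k.1 * t|) ^ 2) *
            ENNReal.ofReal (1 / (1 + |z j - k.2 * t|) ^ 2)) := by
      intro k
      rw [← ENNReal.ofReal_mul (by positivity), ← ENNReal.ofReal_mul (by positivity)]
      exact congrArg ENNReal.ofReal (mul_assoc _ _ _)
    simp_rw [e]
    rw [ENNReal.tsum_mul_left,
      ENNReal.tsum_prod (f := fun a b : ℤ => ENNReal.ofReal (1 / (1 + |y j - a * t|) ^ 2) *
        ENNReal.ofReal (1 / (1 + |z j - b * t|) ^ 2))]
    simp_rw [ENNReal.tsum_mul_left]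
    rw [ENNReal.tsum_mul_right]
    calc _ ≤ ENNReal.ofReal (|t| ^ 3 / (1 + |t|) ^ 6) *
          (ENNReal.ofReal (2 + 2 / |t|) * ENNReal.ofReal (2 + 2 / |t|)) := by
          gcongr <;> exact tsum_int_inv_one_add_abs_sub_sq_le ht _
      _ ≤ _ := by
          rw [← ENNReal.ofReal_mul (by positivity), ← ENNReal.ofReal_mul (by positivity),
            ← ENNReal.ofReal_mul (by positivity)]
          refine ENNReal.ofReal_le_ofReal ?_
          have e2 : |t| ^ 3 / (1 + |t|) ^ 6 * ((2 + 2 / |t|) * (2 + 2 / |t|)) =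
              4 * (|t| / (1 + |t|) ^ 4) := by
            field_simp; ring
          rw [e2]
          gcongr ?_ * (_ / ?_)
          exact pow_le_pow_right₀ (by linarith) (by norm_num)
  refine (ENNReal.tsum_le_tsum hj).trans ?_
  rw [ENNReal.tsum_mul_left, div_eq_mul_one_div, ENNReal.ofReal_mul (by norm_num)]
  gcongr
  exact tsum_geometric_div_one_add_sq_le (abs_nonneg x) h0 h1

/-! ### From feasibility to the weight -/

theorem min_one_abs_mul_rpow_neg_le {r γ : ℝ} (hr : 0 < r) (hγ : 2 ≤ γ) (t : ℝ) :
    min 1 (|r * t| ^ (-γ)) ≤ (4 * (1 + r ^ (-γ))) * (1 / (1 + |t|) ^ 2) := by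
  have hrp : 0 < r ^ (-γ) := Real.rpow_pos_of_pos hr _
  have h0 := abs_nonneg t
  rw [mul_one_div, le_div_iff₀ (by positivity)]
  rcases le_total |t| 1 with h | h
  · have h4 : (1 + |t|) ^ 2 ≤ 4 := by nlinarith
    calc _ ≤ 1 * (1 + |t|) ^ 2 := by gcongr; exact min_le_left _ _
      _ ≤ _ := by nlinarith
  · have h4 : (1 + |t|) ^ 2 ≤ 4 * |t| ^ 2 := by nlinarith
    have h5 : |t| ^ (-γ) * |t| ^ 2 ≤ 1 := by
      rw [← Real.rpow_natCast, ← Real.rpow_add (by linarith)]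
      exact Real.rpow_le_one_of_one_le_of_nonpos h (by push_cast; linarith)
    have h6 : 0 ≤ |t| ^ (-γ) := by positivity
    calc _ ≤ (r ^ (-γ) * |t| ^ (-γ)) * (4 * |t| ^ 2) := by
          gcongr
          refine (min_le_right _ _).trans ?_
          rw [abs_mul, abs_of_pos hr, Real.mul_rpow hr.le h0]
      _ = 4 * r ^ (-γ) * (|t| ^ (-γ) * |t| ^ 2) := by ring
      _ ≤ 4 * r ^ (-γ) * 1 := by gcongr
      _ ≤ _ := by nlinarith

/-- For |t| ≤ 1 the vanishing order δ ≥ β+3 produces |t|^{β+3}; for |t| ≥ 1 the decay gives exponent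
6-γ ≤ 3 ≤ β+3 after clearing (1+|t|)⁶. -/
theorem min_one_abs_rpow_mul_min_le {q q' β γ δ : ℝ} (hq : 0 < q) (hq' : 0 < q') (hβ : 0 ≤ β)
    (hγ : 3 ≤ γ) (hδ : 3 + β ≤ δ) {t : ℝ} (ht : t ≠ 0) :
    min 1 (|q * t| ^ δ) * min 1 (|q' * t| ^ (-γ)) ≤
      (64 * (q ^ δ + q' ^ (-γ))) * |t| ^ β * (|t| ^ 3 / (1 + |t|) ^ 6) := by
  have hqp : 0 < q ^ δ := Real.rpow_pos_of_pos hq _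
  have hqp' : 0 < q' ^ (-γ) := Real.rpow_pos_of_pos hq' _
  have h0 : 0 < |t| := abs_pos.2 ht
  rw [← mul_div_assoc, le_div_iff₀ (by positivity)]
  have hm1 : 0 ≤ min 1 (|q * t| ^ δ) := le_min zero_le_one (by positivity)
  have hm2 : 0 ≤ min 1 (|q' * t| ^ (-γ)) := le_min zero_le_one (by positivity)
  rcases le_total |t| 1 with h | h
  · have h4 : (1 + |t|) ^ 6 ≤ 64 := by
      calc (1 + |t|) ^ 6 ≤ (1 + 1) ^ 6 := by gcongr
        _ = 64 := by norm_num
    have h5 : |t| ^ δ ≤ |t| ^ β * |t| ^ 3 := by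
      rw [← Real.rpow_natCast, ← Real.rpow_add h0]
      exact Real.rpow_le_rpow_of_exponent_ge h0 h (by push_cast; linarith)
    calc _ ≤ (q ^ δ * (|t| ^ β * |t| ^ 3)) * 1 * 64 := by
          gcongr
          · refine (min_le_right _ _).trans ?_
            rw [abs_mul, abs_of_pos hq, Real.mul_rpow hq.le h0.le]
            gcongr
          · exact min_le_left _ _
      _ ≤ _ := by
          have : 0 ≤ q' ^ (-γ) * (|t| ^ β * |t| ^ 3) := by positivity
          nlinarith
  · have h4 : (1 + |t|) ^ 6 ≤ 64 * |t| ^ 6 := by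
      calc (1 + |t|) ^ 6 ≤ (|t| + |t|) ^ 6 := by gcongr
        _ = 64 * |t| ^ 6 := by ring
    have h5 : |t| ^ (-γ) * |t| ^ 6 ≤ |t| ^ β * |t| ^ 3 := by
      rw [← Real.rpow_natCast, ← Real.rpow_natCast, ← Real.rpow_add h0, ← Real.rpow_add h0]
      exact Real.rpow_le_rpow_of_exponent_le h (by push_cast; linarith)
    calc _ ≤ 1 * (q' ^ (-γ) * |t| ^ (-γ)) * (64 * |t| ^ 6) := by
          gcongr
          · exact min_le_left _ _
          · refine (min_le_right _ _).trans ?_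
            rw [abs_mul, abs_of_pos hq', Real.mul_rpow hq'.le h0.le]
      _ = 64 * q' ^ (-γ) * (|t| ^ (-γ) * |t| ^ 6) := by ring
      _ ≤ 64 * q' ^ (-γ) * (|t| ^ β * |t| ^ 3) := by gcongr
      _ ≤ _ := by
          have : 0 ≤ q ^ δ * (|t| ^ β * |t| ^ 3) := by positivity
          nlinarith

theorem ae_apply_ne_zero (i : Fin 3) : ∀ᵐ ξ : R3, ξ i ≠ 0 := by
  have h : ∀ᵐ x : Fin 3 → ℝ, x i ≠ 0 := Measure.ae_eval_ne (μ := fun _ : Fin 3 => volume) i 0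
  exact (PiLp.volume_preserving_ofLp (Fin 3)).quasiMeasurePreserving.ae h

theorem IsFeasible.exists_norm_fourier_le {β γ δ : ℝ} {ψ : L2R3} (hψ : IsFeasible δ γ ψ)
    (hβ : 0 ≤ β) (hγ : 3 ≤ γ) (hδ : 3 + β ≤ δ) :
    ∃ C : ℝ, 0 ≤ C ∧ ∀ᵐ ξ : R3, ξ 0 ≠ 0 ∧
      ‖(𝓕 ψ : L2R3) ξ‖ ≤ C * (|ξ 0| ^ β * shearletWeight ξ) := by
  obtain ⟨C, q, q', r, s, hq', hqq', hr, -, hs, -, h⟩ := hψ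
  have hq := hq'.trans_le hqq'
  -- The absolute value is needed because feasibility does not record the sign of its constant.
  refine ⟨|C| * ((64 * (q ^ δ + q' ^ (-γ))) * (4 * (1 + r ^ (-γ))) * (4 * (1 + s ^ (-γ)))),
    by positivity, ?_⟩
  filter_upwards [h, ae_apply_ne_zero 0] with ξ hξ h0
  refine ⟨h0, hξ.trans ?_⟩
  have hm : ∀ x : ℝ, 0 ≤ x → 0 ≤ min 1 x := fun x hx => le_min zero_le_one hx
  have m3 := hm (|r * ξ 1| ^ (-γ)) (by positivity)
  have m4 := hm (|s * ξ 2| ^ (-γ)) (by positivity)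
  calc _ ≤ |C| * (((64 * (q ^ δ + q' ^ (-γ))) * |ξ 0| ^ β * (|ξ 0| ^ 3 / (1 + |ξ 0|) ^ 6)) *
        ((4 * (1 + r ^ (-γ))) * (1 / (1 + |ξ 1|) ^ 2)) *
        ((4 * (1 + s ^ (-γ))) * (1 / (1 + |ξ 2|) ^ 2))) := by
        have m1 := hm (|q * ξ 0| ^ δ) (by positivity)
        have m2 := hm (|q' * ξ 0| ^ (-γ)) (by positivity)
        refine mul_le_mul (le_abs_self C) ?_ (by positivity) (abs_nonneg C)
        refine mul_le_mul ?_ (min_one_abs_mul_rpow_neg_le hs (by linarith) _) m4 (by positivity)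
        exact mul_le_mul (min_one_abs_rpow_mul_min_le hq hq' hβ hγ hδ h0)
          (min_one_abs_mul_rpow_neg_le hr (by linarith) _) m3 (by positivity)
    _ = _ := by
        unfold shearletWeight; ring

/-! ### Trigonometric polynomials and a weighted Bessel inequality -/

theorem continuous_circle_coe : Continuous fun z : Circle => (z : ℂ) := by fun_prop

/-- The half-open box with side lengths `1 / d i` at the lattice position `l`. -/
def latticeBox (d : Fin 3 → ℝ) (l : Fin 3 → ℤ) : Set (Fin 3 → ℝ) :=
  Set.univ.pi fun i => Set.Ico ((l i : ℝ) / d i) (((l i : ℝ) + 1) / d i)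

theorem measurableSet_latticeBox (d : Fin 3 → ℝ) (l : Fin 3 → ℤ) :
    MeasurableSet (latticeBox d l) :=
  MeasurableSet.univ_pi fun _ => measurableSet_Ico

/-- A trigonometric polynomial with frequencies in the lattice `diag(d) ℤ³`. -/
noncomputable def trigPoly (d : Fin 3 → ℝ) (S : Finset (Fin 3 → ℤ)) (b : (Fin 3 → ℤ) → ℂ)
    (x : Fin 3 → ℝ) : ℂ :=
  ∑ m ∈ S, b m * (Real.fourierChar (∑ i, d i * m i * x i) : ℂ)

theorem continuous_trigPoly (d : Fin 3 → ℝ) (S : Finset (Fin 3 → ℤ)) (b : (Fin 3 → ℤ) → ℂ) :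
    Continuous (trigPoly d S b) := by
  unfold trigPoly
  refine continuous_finsetSum _ fun m _ => continuous_const.mul ?_
  exact continuous_circle_coe.comp (Real.continuous_fourierChar.comp (by fun_prop))

theorem setIntegral_Ico_fourierChar {d : ℝ} (hd : 0 < d) (l n : ℤ) :
    ∫ t in Set.Ico ((l : ℝ) / d) (((l : ℝ) + 1) / d), (Real.fourierChar (d * n * t) : ℂ) =
      if n = 0 then ((1 / d : ℝ) : ℂ) else 0 := by
  have hle : (l : ℝ) / d ≤ ((l : ℝ) + 1) / d := by gcongr; linarith
  rw [integral_Ico_eq_integral_Ioo, ← integral_Ioc_eq_integral_Ioo,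
    ← intervalIntegral.integral_of_le hle]
  split_ifs with hn
  · subst hn
    simp
    field_simp
    ring_nf
  · have hc : (2 * Real.pi * d * n * Complex.I : ℂ) ≠ 0 := by
      have : (Real.pi : ℂ) ≠ 0 := by exact_mod_cast Real.pi_ne_zero
      have : (d : ℂ) ≠ 0 := by exact_mod_cast hd.ne'
      have : (n : ℂ) ≠ 0 := by exact_mod_cast hn
      simp [*]
    have e : ∀ t : ℝ, (Real.fourierChar (d * n * t) : ℂ) =
        Complex.exp ((2 * Real.pi * d * n * Complex.I) * t) := by
      intro t
      rw [Real.fourierChar_apply]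
      congr 1
      push_cast; ring
    simp_rw [e]
    rw [integral_exp_mul_complex hc]
    have hd' : (d : ℂ) ≠ 0 := by exact_mod_cast hd.ne'
    have e2 : (2 * Real.pi * d * n * Complex.I : ℂ) * (((l : ℝ) + 1) / d : ℝ) =
        (2 * Real.pi * d * n * Complex.I) * ((l : ℝ) / d : ℝ) + n * (2 * Real.pi * Complex.I) := by
      push_cast
      field_simp
    rw [e2, Complex.exp_add, Complex.exp_int_mul_two_pi_mul_I]
    simp

theorem setIntegral_latticeBox_fourierChar {d : Fin 3 → ℝ} (hd : ∀ i, 0 < d i)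
    (l m : Fin 3 → ℤ) :
    ∫ x in latticeBox d l, (Real.fourierChar (∑ i, d i * m i * x i) : ℂ) =
      if m = 0 then ((∏ i, 1 / d i : ℝ) : ℂ) else 0 := by
  have e : ∀ x : Fin 3 → ℝ, (Real.fourierChar (∑ i, d i * m i * x i) : ℂ) =
      ∏ i, (fun (i : Fin 3) (t : ℝ) => (Real.fourierChar (d i * m i * t) : ℂ)) i (x i) := by
    intro x
    simp only [Fin.sum_univ_three, Fin.prod_univ_three, AddChar.map_add_eq_mul, Circle.coe_mul]
  rw [integral_congr_ae (ae_of_all _ e)]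
  rw [latticeBox, volume_pi, Measure.restrict_pi_pi, integral_fintype_prod_eq_prod
    (fun (i : Fin 3) (t : ℝ) => (Real.fourierChar (d i * m i * t) : ℂ))]
  simp_rw [setIntegral_Ico_fourierChar (hd _)]
  split_ifs with hm
  · subst hm; simp
  · obtain ⟨i, hi⟩ := Function.ne_iff.1 hm
    exact Finset.prod_eq_zero (Finset.mem_univ i) (if_neg hi)

theorem integrableOn_latticeBox {f : (Fin 3 → ℝ) → ℂ} (hf : Continuous f) (d : Fin 3 → ℝ)
    (l : Fin 3 → ℤ) : IntegrableOn f (latticeBox d l) := by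
  refine (hf.continuousOn.integrableOn_compact (isCompact_univ_pi fun i =>
    isCompact_Icc (a := (l i : ℝ) / d i) (b := ((l i : ℝ) + 1) / d i))).mono_set ?_
  exact Set.pi_mono fun i _ => Set.Ico_subset_Icc_self

/-- Every box is a full period, so orthogonality leaves only the diagonal terms and the energy is
the same on all boxes. -/
theorem setLIntegral_latticeBox_trigPoly_sq {d : Fin 3 → ℝ} (hd : ∀ i, 0 < d i) (l : Fin 3 → ℤ)
    (S : Finset (Fin 3 → ℤ)) (b : (Fin 3 → ℤ) → ℂ) :
    ∫⁻ x in latticeBox d l, ‖trigPoly d S b x‖ₑ ^ 2 =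
      ENNReal.ofReal (∏ i, 1 / d i) * ∑ m ∈ S, ‖b m‖ₑ ^ 2 := by
  have hT := continuous_trigPoly d S b
  have h1 : ∫ x in latticeBox d l, ((‖trigPoly d S b x‖ ^ 2 : ℝ) : ℂ) =
      (((∏ i, 1 / d i) * ∑ m ∈ S, ‖b m‖ ^ 2 : ℝ) : ℂ) := by
    have e : ∀ x, ((‖trigPoly d S b x‖ ^ 2 : ℝ) : ℂ) = ∑ m ∈ S, ∑ n ∈ S,
        b m * (starRingEnd ℂ) (b n) * (Real.fourierChar (∑ i, d i * (m - n) i * x i) : ℂ) := by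
      intro x
      push_cast
      rw [← Complex.mul_conj', trigPoly, map_sum, Finset.sum_mul_sum]
      refine Finset.sum_congr rfl fun m _ => Finset.sum_congr rfl fun n _ => ?_
      have e1 : ∑ i, d i * ((m - n) i : ℤ) * x i =
          (∑ i, d i * m i * x i) + -(∑ i, d i * n i * x i) := by
        rw [← Finset.sum_neg_distrib, ← Finset.sum_add_distrib]
        refine Finset.sum_congr rfl fun i _ => ?_
        rw [Pi.sub_apply]; push_cast; ring
      have e2 : (Real.fourierChar (∑ i, d i * ((m - n) i : ℤ) * x i) : ℂ) =
          (Real.fourierChar (∑ i, d i * m i * x i) : ℂ) *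
            (starRingEnd ℂ) (Real.fourierChar (∑ i, d i * n i * x i) : ℂ) := by
        rw [e1, AddChar.map_add_eq_mul, AddChar.map_neg_eq_inv, Circle.coe_mul,
          Circle.coe_inv_eq_conj]
      simp only [Int.cast_sub, Pi.sub_apply] at e2 ⊢
      rw [e2, map_mul]
      ring
    have hc : ∀ m n : Fin 3 → ℤ, Continuous fun x : Fin 3 → ℝ =>
        b m * (starRingEnd ℂ) (b n) * (Real.fourierChar (∑ i, d i * (m - n) i * x i) : ℂ) := by
      intro m n
      exact continuous_const.mul
        (continuous_circle_coe.comp (Real.continuous_fourierChar.comp (by fun_prop)))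
    simp_rw [e]
    rw [integral_finsetSum _ fun m _ => integrable_finsetSum _ fun n _ =>
      integrableOn_latticeBox (hc m n) d l]
    have h2 : ∀ m ∈ S, ∫ x in latticeBox d l, ∑ n ∈ S,
        b m * (starRingEnd ℂ) (b n) * (Real.fourierChar (∑ i, d i * (m - n) i * x i) : ℂ) =
        ((∏ i, 1 / d i : ℝ) : ℂ) * ((‖b m‖ ^ 2 : ℝ) : ℂ) := by
      intro m hm
      rw [integral_finsetSum _ fun n _ => integrableOn_latticeBox (hc m n) d l]
      simp_rw [integral_const_mul, setIntegral_latticeBox_fourierChar hd, sub_eq_zero]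
      rw [Finset.sum_eq_single m]
      · rw [if_pos rfl, Complex.mul_conj']
        push_cast; ring
      · intro n _ hn
        rw [if_neg (Ne.symm hn), mul_zero]
      · exact fun h => absurd hm h
    rw [Finset.sum_congr rfl h2, ← Finset.mul_sum]
    push_cast; rfl
  rw [integral_complex_ofReal] at h1
  have h2 := Complex.ofReal_injective h1
  have h3 : ∀ x, ‖trigPoly d S b x‖ₑ ^ 2 = ENNReal.ofReal (‖trigPoly d S b x‖ ^ 2) := by
    intro x
    rw [ENNReal.ofReal_pow (norm_nonneg _), ofReal_norm]
  simp_rw [h3]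
  rw [← ofReal_integral_eq_lintegral_ofReal, h2, ENNReal.ofReal_mul
    (Finset.prod_nonneg fun i _ => (one_div_pos.2 (hd i)).le),
    ENNReal.ofReal_sum_of_nonneg fun _ _ => by positivity]
  · simp_rw [ENNReal.ofReal_pow (norm_nonneg _), ofReal_norm]
  · have := integrableOn_latticeBox (Complex.continuous_ofReal.comp (hT.norm.pow 2)) d l
    exact this.re
  · exact ae_of_all _ fun x => by positivity

/-- The constant by which the decay weight on a box exceeds its value at the lattice position. -/
theorem one_div_one_add_abs_sq_le {d : ℝ} (hd : 0 < d) (x : ℝ) :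
    1 / (1 + |x|) ^ 2 ≤ (1 + 1 / d) ^ 2 * (1 / (1 + |0 - (⌊d * x⌋ : ℝ) * (1 / d)|) ^ 2) := by
  rw [mul_one_div, div_le_div_iff₀ (by positivity) (by positivity), one_mul, ← mul_pow]
  refine pow_le_pow_left₀ (by positivity) ?_ 2
  have h1 : |(⌊d * x⌋ : ℝ)| ≤ d * |x| + 1 := by
    have h2 : (⌊d * x⌋ : ℝ) ≤ d * x := Int.floor_le _
    have h3 : d * x < (⌊d * x⌋ : ℝ) + 1 := Int.lt_floor_add_one _
    have h4 : |d * x| = d * |x| := by rw [abs_mul, abs_of_pos hd]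
    rw [← h4, abs_le]
    constructor
    · have := neg_abs_le (d * x); linarith
    · have := le_abs_self (d * x); linarith
  have h5 : |0 - (⌊d * x⌋ : ℝ) * (1 / d)| ≤ |x| + 1 / d := by
    rw [zero_sub, abs_neg, abs_mul, abs_of_pos (one_div_pos.2 hd)]
    calc _ ≤ (d * |x| + 1) * (1 / d) := by gcongr
      _ = _ := by field_simp
  have h6 : 0 ≤ 1 / d * |x| := by positivity
  nlinarith

/-- The period boxes tile space. On each one the decay weight is at most a constant `w`, the
polynomial has the same energy everywhere, and the constants are summable over the lattice. -/
theorem exists_lintegral_trigPoly_sq_mul_le {d : Fin 3 → ℝ} (hd : ∀ i, 0 < d i) :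
    ∃ K : ℝ≥0∞, K ≠ ∞ ∧ ∀ (S : Finset (Fin 3 → ℤ)) (b : (Fin 3 → ℤ) → ℂ),
      ∫⁻ x : Fin 3 → ℝ, ‖trigPoly d S b x‖ₑ ^ 2 * ENNReal.ofReal
        (1 / (1 + |x 0|) ^ 2 * (1 / (1 + |x 1|) ^ 2) * (1 / (1 + |x 2|) ^ 2)) ≤
        K * ∑ m ∈ S, ‖b m‖ₑ ^ 2 := by
  set w : Fin 3 → ℤ → ℝ≥0∞ := fun i l =>
    ENNReal.ofReal ((1 + 1 / d i) ^ 2 * (1 / (1 + |0 - (l : ℝ) * (1 / d i)|) ^ 2)) with hw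
  have hws : ∀ i, ∑' l, w i l ≠ ∞ := by
    intro i
    have h1 := tsum_int_inv_one_add_abs_sub_sq_le (one_div_pos.2 (hd i)).ne' 0
    simp_rw [hw, ENNReal.ofReal_mul (sq_nonneg (1 + 1 / d i))]
    rw [ENNReal.tsum_mul_left]
    exact ENNReal.mul_ne_top ENNReal.ofReal_ne_top (ne_top_of_le_ne_top ENNReal.ofReal_ne_top h1)
  refine ⟨((∑' l, w 0 l) * ((∑' l, w 1 l) * (∑' l, w 2 l))) * ENNReal.ofReal (∏ i, 1 / d i),
    ENNReal.mul_ne_top (ENNReal.mul_ne_top (hws 0) (ENNReal.mul_ne_top (hws 1) (hws 2)))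
      ENNReal.ofReal_ne_top, fun S b => ?_⟩
  have hpt : ∀ x : Fin 3 → ℝ, ‖trigPoly d S b x‖ₑ ^ 2 * ENNReal.ofReal
        (1 / (1 + |x 0|) ^ 2 * (1 / (1 + |x 1|) ^ 2) * (1 / (1 + |x 2|) ^ 2)) ≤
      ∑' p : ℤ × ℤ × ℤ, (w 0 p.1 * (w 1 p.2.1 * w 2 p.2.2)) *
        (latticeBox d ![p.1, p.2.1, p.2.2]).indicator (fun x => ‖trigPoly d S b x‖ₑ ^ 2) x := by
    intro x
    refine le_trans ?_ (ENNReal.le_tsum (⌊d 0 * x 0⌋, ⌊d 1 * x 1⌋, ⌊d 2 * x 2⌋))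
    have hmem : x ∈ latticeBox d ![⌊d 0 * x 0⌋, ⌊d 1 * x 1⌋, ⌊d 2 * x 2⌋] := by
      have h1 : ∀ i, (⌊d i * x i⌋ : ℝ) / d i ≤ x i ∧ x i < ((⌊d i * x i⌋ : ℝ) + 1) / d i := by
        intro i
        rw [div_le_iff₀' (hd i), lt_div_iff₀' (hd i)]
        exact ⟨Int.floor_le _, Int.lt_floor_add_one _⟩
      intro i _
      fin_cases i
      · exact h1 0
      · exact h1 1
      · exact h1 2
    rw [Set.indicator_of_mem hmem, mul_comm]
    gcongr
    simp only [hw]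
    rw [← ENNReal.ofReal_mul (by positivity), ← ENNReal.ofReal_mul (by positivity), ← mul_assoc]
    refine ENNReal.ofReal_le_ofReal ?_
    refine mul_le_mul (mul_le_mul ?_ ?_ ?_ ?_) ?_ ?_ ?_
    · exact one_div_one_add_abs_sq_le (hd 0) _
    · exact one_div_one_add_abs_sq_le (hd 1) _
    · positivity
    · positivity
    · exact one_div_one_add_abs_sq_le (hd 2) _
    · positivity
    · positivity
  have hmeas : Measurable fun x => ‖trigPoly d S b x‖ₑ ^ 2 :=
    (continuous_trigPoly d S b).measurable.enorm.pow_const 2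
  refine (lintegral_mono hpt).trans ?_
  rw [lintegral_tsum fun p => ((hmeas.indicator (measurableSet_latticeBox _ _)).const_mul
    _).aemeasurable]
  have hbox : ∀ p : ℤ × ℤ × ℤ, ∫⁻ x, (w 0 p.1 * (w 1 p.2.1 * w 2 p.2.2)) *
        (latticeBox d ![p.1, p.2.1, p.2.2]).indicator (fun x => ‖trigPoly d S b x‖ₑ ^ 2) x =
      (w 0 p.1 * (w 1 p.2.1 * w 2 p.2.2)) *
        (ENNReal.ofReal (∏ i, 1 / d i) * ∑ m ∈ S, ‖b m‖ₑ ^ 2) := by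
    intro p
    rw [lintegral_const_mul _ (hmeas.indicator (measurableSet_latticeBox _ _)),
      lintegral_indicator (measurableSet_latticeBox _ _),
      setLIntegral_latticeBox_trigPoly_sq hd]
  simp_rw [hbox]
  rw [ENNReal.tsum_mul_right, ENNReal.tsum_prod (f := fun a (q : ℤ × ℤ) =>
    w 0 a * (w 1 q.1 * w 2 q.2))]
  simp_rw [ENNReal.tsum_mul_left]
  rw [ENNReal.tsum_mul_right, ENNReal.tsum_prod (f := fun a b => w 1 a * w 2 b)]
  simp_rw [ENNReal.tsum_mul_left]
  rw [ENNReal.tsum_mul_right, mul_assoc (_ * _)]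

theorem inner_latticePoint (c : ℝ × ℝ) (m : Fin 3 → ℤ) (η : R3) :
    inner ℝ (latticePoint c m) η = ∑ i, (![c.1, c.2, c.2] i) * (m i) * η i := by
  simp [PiLp.inner_apply, latticePoint, latticeMatrix, dotProduct,
    Fin.sum_univ_three]
  ring

theorem lintegral_mul_sq_le {f g : R3 → ℝ≥0∞} (hf : AEMeasurable f) (hg : AEMeasurable g) :
    (∫⁻ x, f x * g x) ^ 2 ≤ (∫⁻ x, f x ^ 2) * ∫⁻ x, g x ^ 2 := by
  have h := ENNReal.lintegral_mul_le_Lp_mul_Lq volume Real.HolderConjugate.two_two hf hg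
  simp only [Pi.mul_apply, ENNReal.rpow_two] at h
  refine (pow_le_pow_left₀ (by positivity) h 2).trans_eq ?_
  rw [mul_pow, ← ENNReal.rpow_mul_natCast, ← ENNReal.rpow_mul_natCast]
  norm_num

/-- A Bessel inequality for the Fourier coefficients, with respect to the lattice `M_c ℤ³`, of a
function dominated by a multiple of the decaying weight. -/
theorem exists_tsum_enorm_fourierCoeff_sq_le {c : ℝ × ℝ} (hc1 : 0 < c.1) (hc2 : 0 < c.2) :
    ∃ K : ℝ≥0∞, K ≠ ∞ ∧ ∀ (F : R3 → ℂ) (u : R3 → ℝ≥0∞), Integrable F → AEMeasurable u →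
      (∀ᵐ η, ‖F η‖ₑ ≤ u η * ENNReal.ofReal (shearletWeight η)) →
      ∑' m : Fin 3 → ℤ, ‖∫ η, F η * (Real.fourierChar (inner ℝ (latticePoint c m) η) : ℂ)‖ₑ ^ 2 ≤
        K * ∫⁻ η, u η ^ 2 * ENNReal.ofReal (shearletWeight η) := by
  have hd : ∀ i, 0 < (![c.1, c.2, c.2] : Fin 3 → ℝ) i := by
    intro i; fin_cases i <;> assumption
  obtain ⟨K, hK, hKb⟩ := exists_lintegral_trigPoly_sq_mul_le hd
  refine ⟨K, hK, fun F u hF hu hFu => ?_⟩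
  rw [ENNReal.tsum_eq_iSup_sum]
  refine iSup_le fun S => ?_
  set a : (Fin 3 → ℤ) → ℂ := fun m =>
    ∫ η, F η * (Real.fourierChar (inner ℝ (latticePoint c m) η) : ℂ) with ha
  -- Duality: with conjugated coefficients, pairing `F` with `T` returns the square sum `X` itself.
  set T : R3 → ℂ := fun η => trigPoly ![c.1, c.2, c.2] S (fun m => (starRingEnd ℂ) (a m)) η.ofLp
    with hT
  have hTc : Continuous T := (continuous_trigPoly _ _ _).comp (PiLp.continuous_ofLp 2 _)
  set X : ℝ≥0∞ := ∑ m ∈ S, ‖a m‖ₑ ^ 2 with hX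
  have hXtop : X ≠ ∞ := ENNReal.sum_ne_top.2 fun m _ => ENNReal.pow_ne_top enorm_ne_top
  have hint : ∀ m : Fin 3 → ℤ, Integrable
      fun η => F η * (Real.fourierChar (inner ℝ (latticePoint c m) η) : ℂ) := by
    intro m
    refine hF.mul_bdd (c := 1) ?_ (ae_of_all _ fun η => (Circle.norm_coe _).le)
    exact (continuous_circle_coe.comp (Real.continuous_fourierChar.comp
      (by fun_prop))).aestronglyMeasurable
  have h1 : ∫ η, F η * T η = ((∑ m ∈ S, ‖a m‖ ^ 2 : ℝ) : ℂ) := by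
    have e : ∀ η, F η * T η = ∑ m ∈ S, (starRingEnd ℂ) (a m) *
        (F η * (Real.fourierChar (inner ℝ (latticePoint c m) η) : ℂ)) := by
      intro η
      simp only [hT, trigPoly]
      rw [Finset.mul_sum]
      refine Finset.sum_congr rfl fun m _ => ?_
      rw [inner_latticePoint]
      ring
    simp_rw [e]
    rw [integral_finsetSum _ fun m _ => (hint m).const_mul _]
    push_cast
    refine Finset.sum_congr rfl fun m _ => ?_
    rw [integral_const_mul, ← Complex.conj_mul']
  -- The weight is split into two square roots, preparing Cauchy–Schwarz: one half goes with `u`,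
  -- the other with `T`.
  have h2 : X ≤ ∫⁻ η, (u η * ENNReal.ofReal √(shearletWeight η)) *
      (‖T η‖ₑ * ENNReal.ofReal √(shearletWeight η)) := by
    have e : X = ‖∫ η, F η * T η‖ₑ := by
      rw [h1, ← ofReal_norm, Complex.norm_real, Real.norm_of_nonneg (by positivity),
        ENNReal.ofReal_sum_of_nonneg fun _ _ => by positivity, hX]
      simp_rw [ENNReal.ofReal_pow (norm_nonneg _), ofReal_norm]
    rw [e]
    refine (enorm_integral_le_lintegral_enorm _).trans (lintegral_mono_ae ?_)
    filter_upwards [hFu] with η hη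
    rw [enorm_mul]
    calc _ ≤ u η * ENNReal.ofReal (shearletWeight η) * ‖T η‖ₑ := by gcongr
      _ = _ := by
        nth_rw 1 [← Real.mul_self_sqrt (shearletWeight_nonneg η)]
        rw [ENNReal.ofReal_mul (Real.sqrt_nonneg _)]
        ring
  have hWm : Measurable fun η => ENNReal.ofReal √(shearletWeight η) :=
    (continuous_shearletWeight.sqrt).measurable.ennreal_ofReal
  have hsq : ∀ η, ENNReal.ofReal √(shearletWeight η) ^ 2 = ENNReal.ofReal (shearletWeight η) := by
    intro η
    rw [← ENNReal.ofReal_pow (Real.sqrt_nonneg _), Real.sq_sqrt (shearletWeight_nonneg η)]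
  have h3 := (pow_le_pow_left₀ (by positivity) h2 2).trans
    (lintegral_mul_sq_le (hu.mul hWm.aemeasurable)
      (hTc.measurable.enorm.mul hWm).aemeasurable)
  simp_rw [mul_pow, hsq] at h3
  have h4 : ∫⁻ η, ‖T η‖ₑ ^ 2 * ENNReal.ofReal (shearletWeight η) ≤ K * X := by
    have h5 := hKb S fun m => (starRingEnd ℂ) (a m)
    rw [← (PiLp.volume_preserving_ofLp (Fin 3)).lintegral_comp_emb
      (MeasurableEquiv.toLp 2 (Fin 3 → ℝ)).symm.measurableEmbedding] at h5
    refine le_trans (lintegral_mono fun η => ?_) (h5.trans_eq ?_)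
    · gcongr
      exact shearletWeight_le η
    · simp [hX]
  have h6 : X * X ≤ (K * ∫⁻ η, u η ^ 2 * ENNReal.ofReal (shearletWeight η)) * X := by
    rw [← sq]
    refine h3.trans ?_
    calc _ ≤ (∫⁻ η, u η ^ 2 * ENNReal.ofReal (shearletWeight η)) * (K * X) := by gcongr
      _ = _ := by ring
  -- One factor `X` is cancelled; this is why the sum was first restricted to a finite `S`, making
  -- `X` finite.
  rcases eq_or_ne X 0 with h0 | h0
  · rw [h0]; exact zero_le
  · exact (ENNReal.mul_le_mul_iff_left h0 hXtop).1 h6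

/-! ### The weighted square sum of the coefficients -/

theorem det_shear_mul_scaling (α : ℝ) (j : ℕ) (k : ℤ × ℤ) :
    (shearMatrix k * scalingMatrix α j).det = (2 : ℝ) ^ ((j : ℝ) * (α + 2) / 2) := by
  rw [Matrix.det_mul, shearMatrix, scalingMatrix, Matrix.det_fin_three, Matrix.det_fin_three]
  simp
  rw [← Real.rpow_add two_pos, ← Real.rpow_add two_pos]
  congr 1; ring

theorem shear_mul_scaling_mulVec (α : ℝ) (j : ℕ) (k : ℤ × ℤ) (x : Fin 3 → ℝ) :
    (shearMatrix k * scalingMatrix α j) *ᵥ x =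
      ![(2 : ℝ) ^ (j * α / 2) * x 0 + k.1 * (2 : ℝ) ^ ((j : ℝ) / 2) * x 1 +
          k.2 * (2 : ℝ) ^ ((j : ℝ) / 2) * x 2,
        (2 : ℝ) ^ ((j : ℝ) / 2) * x 1, (2 : ℝ) ^ ((j : ℝ) / 2) * x 2] := by
  ext i
  fin_cases i <;>
    simp [shearMatrix, scalingMatrix, Matrix.mulVec, Matrix.mul_apply, dotProduct,
      Fin.sum_univ_three]

theorem shear_mul_scaling_transpose_mulVec (α : ℝ) (j : ℕ) (k : ℤ × ℤ) (x : Fin 3 → ℝ) :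
    (shearMatrix k * scalingMatrix α j)ᵀ *ᵥ x =
      ![(2 : ℝ) ^ (j * α / 2) * x 0,
        (2 : ℝ) ^ ((j : ℝ) / 2) * (k.1 * x 0 + x 1),
        (2 : ℝ) ^ ((j : ℝ) / 2) * (k.2 * x 0 + x 2)] := by
  ext i
  fin_cases i <;>
    simp [shearMatrix, scalingMatrix, Matrix.mulVec, dotProduct,
      Fin.sum_univ_three] <;> ring

theorem CompactlySupported.integrable {ψ : L2R3} (hψ : CompactlySupported ψ) :
    Integrable (ψ : R3 → ℂ) := by
  obtain ⟨K, hK, hs⟩ := hψ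
  have h1 : IntegrableOn (ψ : R3 → ℂ) K := by
    have : IsFiniteMeasure (volume.restrict K) := ⟨by
      rw [Measure.restrict_apply_univ]; exact hK.measure_lt_top⟩
    exact ((Lp.memLp ψ).restrict K).integrable (by norm_num)
  exact h1.integrable_of_ae_notMem_eq_zero hs

/-- The frequency `η` with `(S_k A_{2^j})ᵀ η = ξ`. -/
noncomputable def shearFrequency (α : ℝ) (j : ℕ) (k : ℤ × ℤ) (ξ : R3) : R3 :=
  !₂[((2 : ℝ) ^ (-(α / 2))) ^ j * ξ 0,
    ξ 1 / (2 : ℝ) ^ ((j : ℝ) / 2) - k.1 * (((2 : ℝ) ^ (-(α / 2))) ^ j * ξ 0),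
    ξ 2 / (2 : ℝ) ^ ((j : ℝ) / 2) - k.2 * (((2 : ℝ) ^ (-(α / 2))) ^ j * ξ 0)]

theorem continuous_shearFrequency (α : ℝ) (j : ℕ) (k : ℤ × ℤ) :
    Continuous (shearFrequency α j k) := by
  unfold shearFrequency
  refine (PiLp.continuous_toLp 2 _).comp (continuous_pi fun i => ?_)
  fin_cases i <;> simp <;> fun_prop

theorem two_rpow_neg_pow_mul (α : ℝ) (j : ℕ) :
    ((2 : ℝ) ^ (-(α / 2))) ^ j * (2 : ℝ) ^ (j * α / 2) = 1 := by
  rw [← Real.rpow_mul_natCast two_pos.le, ← Real.rpow_add two_pos]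
  convert Real.rpow_zero (2 : ℝ) using 2
  ring

theorem shearFrequency_transpose_mulVec (α : ℝ) (j : ℕ) (k : ℤ × ℤ) (η : R3) :
    shearFrequency α j k
      (WithLp.toLp 2 ((shearMatrix k * scalingMatrix α j)ᵀ *ᵥ η.ofLp)) = η := by
  have h := two_rpow_neg_pow_mul α j
  have hb : (2 : ℝ) ^ ((j : ℝ) / 2) ≠ 0 := by positivity
  have h' : ((2 : ℝ) ^ (-(α / 2))) ^ j * ((2 : ℝ) ^ (j * α / 2) * η 0) = η 0 := by
    rw [← mul_assoc, h, one_mul]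
  rw [shear_mul_scaling_transpose_mulVec]
  ext i
  fin_cases i
  · simpa [shearFrequency] using h'
  · simp [shearFrequency, h']; field_simp; ring
  · simp [shearFrequency, h']; field_simp; ring

/-- The coefficients at one scale and shear are controlled by the energy of the Sobolev density
`h` of `g` in the corresponding frequency region. -/
theorem tsum_shearlet_sq_le {α β C : ℝ} {c : ℝ × ℝ} {ψ g h : L2R3} {K : ℝ≥0∞}
    (hK : ∀ (F : R3 → ℂ) (u : R3 → ℝ≥0∞), Integrable F → AEMeasurable u →
      (∀ᵐ η, ‖F η‖ₑ ≤ u η * ENNReal.ofReal (shearletWeight η)) →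
      ∑' m : Fin 3 → ℤ, ‖∫ η, F η * (Real.fourierChar (inner ℝ (latticePoint c m) η) : ℂ)‖ₑ ^ 2 ≤
        K * ∫⁻ η, u η ^ 2 * ENNReal.ofReal (shearletWeight η))
    (hβ : 0 ≤ β) (hC : 0 ≤ C) (hψi : Integrable ψ)
    (hψ : ∀ᵐ ξ : R3, ξ 0 ≠ 0 ∧ ‖(𝓕 ψ : L2R3) ξ‖ ≤ C * (|ξ 0| ^ β * shearletWeight ξ))
    (hg : ∀ᵐ ξ, (𝓕 g : L2R3) ξ = (((1 + ‖ξ‖ ^ 2) ^ (-(β / 2)) : ℝ) : ℂ) * h ξ)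
    (j : ℕ) (k : ℤ × ℤ) :
    ENNReal.ofReal ((2 : ℝ) ^ (j * α * β)) * ∑' m : Fin 3 → ℤ,
        ‖∫ x : R3, g x * (starRingEnd ℂ) (shearlet α c ψ j k m x)‖ₑ ^ 2 ≤
      K * ENNReal.ofReal (C ^ 2) *
        ∫⁻ ξ, ‖h ξ‖ₑ ^ 2 * ENNReal.ofReal (shearletWeight (shearFrequency α j k ξ)) := by
  set M := shearMatrix k * scalingMatrix α j with hMdef
  have hdet : M.det = (2 : ℝ) ^ ((j : ℝ) * (α + 2) / 2) := det_shear_mul_scaling α j k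
  have hdpos : 0 < M.det := by rw [hdet]; positivity
  have hM : M.det ≠ 0 := hdpos.ne'
  have hMt : Mᵀ.det ≠ 0 := by rwa [Matrix.det_transpose]
  set a : ℝ := (2 : ℝ) ^ (j * α / 2) with ha
  have hapos : 0 < a := by positivity
  set F : R3 → ℂ := fun η => (𝓕 g : L2R3) (WithLp.toLp 2 (Mᵀ *ᵥ η.ofLp)) *
    (starRingEnd ℂ) ((𝓕 ψ : L2R3) η) with hF
  have hcoef : ∀ m : Fin 3 → ℤ,
      ‖∫ x : R3, g x * (starRingEnd ℂ) (shearlet α c ψ j k m x)‖ₑ ^ 2 = ENNReal.ofReal M.det *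
        ‖∫ η, F η * (Real.fourierChar (inner ℝ (latticePoint c m) η) : ℂ)‖ₑ ^ 2 := by
    intro m
    have e : ∀ x : R3, g x * (starRingEnd ℂ) (shearlet α c ψ j k m x) =
        (((2 : ℝ) ^ (j * (α + 2) / 4) : ℝ) : ℂ) *
          (g x * (starRingEnd ℂ) (ψ (WithLp.toLp 2 (M *ᵥ x.ofLp) - latticePoint c m))) := by
      intro x
      rw [shearlet, map_mul, Complex.conj_ofReal]
      ring
    simp_rw [e]
    rw [integral_const_mul, integral_mul_conj_comp_mulVec_sub hM _ g ψ hψi, enorm_mul, mul_pow]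
    congr 1
    rw [← ofReal_norm, Complex.norm_real, Real.norm_of_nonneg (by positivity),
      ← ENNReal.ofReal_pow (by positivity), hdet, ← Real.rpow_mul_natCast two_pos.le]
    congr 2
    push_cast; ring
  have hqmp := quasiMeasurePreserving_mulVec_sub hMt 0
  simp only [sub_zero] at hqmp
  have hFi : Integrable F := by
    have h1 := memLp_comp_mulVec_sub hMt 0 (Lp.memLp (𝓕 g : L2R3))
    simp only [sub_zero] at h1
    exact h1.integrable_mul (Lp.memLp (𝓕 ψ : L2R3)).star
  set u : R3 → ℝ≥0∞ := fun η =>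
    ENNReal.ofReal (C * a ^ (-β)) * ‖h (WithLp.toLp 2 (Mᵀ *ᵥ η.ofLp))‖ₑ with hu
  have hum : AEMeasurable u :=
    ((Lp.aestronglyMeasurable h).comp_quasiMeasurePreserving hqmp).enorm.const_mul _
  have hFu : ∀ᵐ η, ‖F η‖ₑ ≤ u η * ENNReal.ofReal (shearletWeight η) := by
    filter_upwards [hqmp.ae hg, hψ] with η h1 h2
    obtain ⟨h0, h2⟩ := h2
    set ξ : R3 := WithLp.toLp 2 (Mᵀ *ᵥ η.ofLp) with hξ
    have hξ0 : ξ 0 = a * η 0 := by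
      rw [hξ, hMdef, shear_mul_scaling_transpose_mulVec]; simp [ha]
    have hη : 0 < |η 0| := abs_pos.2 h0
    -- The Sobolev gain uses only the first frequency coordinate, which the shear leaves unmixed.
    have hle : (1 + ‖ξ‖ ^ 2) ^ (-(β / 2)) ≤ a ^ (-β) * |η 0| ^ (-β) := by
      have h3 : (a * |η 0|) ^ 2 ≤ 1 + ‖ξ‖ ^ 2 := by
        have h4 : |ξ 0| ≤ ‖ξ‖ := PiLp.norm_apply_le ξ 0
        rw [hξ0, abs_mul, abs_of_pos hapos] at h4
        nlinarith [pow_le_pow_left₀ (by positivity) h4 2]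
      calc (1 + ‖ξ‖ ^ 2) ^ (-(β / 2)) ≤ ((a * |η 0|) ^ 2) ^ (-(β / 2)) :=
            Real.rpow_le_rpow_of_nonpos (by positivity) h3 (by linarith)
        _ = _ := by
            rw [← Real.rpow_natCast_mul (by positivity), ← Real.mul_rpow hapos.le hη.le]
            congr 1
            push_cast; ring
    have hn : ‖F η‖ ≤ C * a ^ (-β) * ‖h ξ‖ * shearletWeight η := by
      rw [hF]
      simp only [norm_mul, RCLike.norm_conj]
      rw [h1, norm_mul, Complex.norm_real, Real.norm_of_nonneg (by positivity)]
      have hw := shearletWeight_nonneg η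
      calc _ ≤ (a ^ (-β) * |η 0| ^ (-β)) * ‖h ξ‖ * (C * (|η 0| ^ β * shearletWeight η)) := by
            gcongr
        _ = C * a ^ (-β) * ‖h ξ‖ * shearletWeight η * (|η 0| ^ (-β) * |η 0| ^ β) := by ring
        _ = _ := by
            rw [← Real.rpow_add hη, neg_add_cancel, Real.rpow_zero, mul_one]
    calc ‖F η‖ₑ = ENNReal.ofReal ‖F η‖ := (ofReal_norm _).symm
      _ ≤ ENNReal.ofReal (C * a ^ (-β) * ‖h ξ‖ * shearletWeight η) := ENNReal.ofReal_le_ofReal hn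
      _ = _ := by
        rw [ENNReal.ofReal_mul (by positivity), ENNReal.ofReal_mul (by positivity), ofReal_norm]
  have hmain := hK F u hFi hum hFu
  simp_rw [hcoef]
  rw [ENNReal.tsum_mul_left]
  -- Returning to ξ yields det⁻¹, which will cancel the determinant coming from the squared
  -- normalisation of the shearlet.
  have hint : ∫⁻ η, u η ^ 2 * ENNReal.ofReal (shearletWeight η) =
      ENNReal.ofReal ((C * a ^ (-β)) ^ 2) * (ENNReal.ofReal M.det⁻¹ *
        ∫⁻ ξ, ‖h ξ‖ₑ ^ 2 * ENNReal.ofReal (shearletWeight (shearFrequency α j k ξ))) := by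
    have h1 := lintegral_comp_mulVec hMt
      fun ξ => ‖h ξ‖ₑ ^ 2 * ENNReal.ofReal (shearletWeight (shearFrequency α j k ξ))
    rw [Matrix.det_transpose, abs_of_pos hdpos] at h1
    simp_rw [hMdef, shearFrequency_transpose_mulVec] at h1
    rw [← hMdef] at h1
    rw [← h1, ← lintegral_const_mul' _ _ ENNReal.ofReal_ne_top]
    refine lintegral_congr fun η => ?_
    rw [hu, mul_pow, ENNReal.ofReal_pow (by positivity), mul_assoc]
  rw [hint] at hmain
  calc _ ≤ ENNReal.ofReal ((2 : ℝ) ^ (j * α * β)) * (ENNReal.ofReal M.det *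
        (K * (ENNReal.ofReal ((C * a ^ (-β)) ^ 2) * (ENNReal.ofReal M.det⁻¹ *
        ∫⁻ ξ, ‖h ξ‖ₑ ^ 2 * ENNReal.ofReal (shearletWeight (shearFrequency α j k ξ)))))) := by
        gcongr
    _ = K * (ENNReal.ofReal ((2 : ℝ) ^ (j * α * β)) * ENNReal.ofReal M.det *
          ENNReal.ofReal ((C * a ^ (-β)) ^ 2) * ENNReal.ofReal M.det⁻¹) *
        ∫⁻ ξ, ‖h ξ‖ₑ ^ 2 * ENNReal.ofReal (shearletWeight (shearFrequency α j k ξ)) := by ring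
    _ = _ := by
        rw [← ENNReal.ofReal_mul (by positivity), ← ENNReal.ofReal_mul (by positivity),
          ← ENNReal.ofReal_mul (by positivity)]
        congr 3
        -- The scale weight is exactly the inverse of the squared Sobolev gain, since a = 2^{jα/2}.
        have h2 : (2 : ℝ) ^ (j * α * β) * (a ^ (-β)) ^ 2 = 1 := by
          rw [ha, ← Real.rpow_mul two_pos.le, ← Real.rpow_mul_natCast two_pos.le,
            ← Real.rpow_add two_pos]
          convert Real.rpow_zero (2 : ℝ) using 2
          push_cast; ring
        have h3 : M.det * M.det⁻¹ = 1 := mul_inv_cancel₀ hM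
        calc _ = C ^ 2 * ((2 : ℝ) ^ (j * α * β) * (a ^ (-β)) ^ 2) * (M.det * M.det⁻¹) := by ring
          _ = _ := by rw [h2, h3]; ring

/-- Tonelli moves the sums over j and k inside the integral, where the weights sum to at most
4/(1-ρ) for almost every ξ. All k ∈ ℤ² are allowed, since the uniform bound does not need the cone
restriction. -/
theorem tsum_weighted_shearlet_sq_ne_top {α β δ γ : ℝ} {c : ℝ × ℝ} {ψ g : L2R3}
    (hα : 0 < α) (hc1 : 0 < c.1) (hc2 : 0 < c.2) (hβ : 0 ≤ β) (hg : InSobolev β g)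
    (hψsupp : CompactlySupported ψ) (hψ : IsFeasible δ γ ψ) (hδ : 3 + β ≤ δ) (hγ : 3 ≤ γ) :
    ∑' p : ℕ × (ℤ × ℤ) × (Fin 3 → ℤ), ENNReal.ofReal ((2 : ℝ) ^ (p.1 * α * β)) *
      ‖∫ x : R3, g x * (starRingEnd ℂ) (shearlet α c ψ p.1 p.2.1 p.2.2 x)‖ₑ ^ 2 ≠ ∞ := by
  obtain ⟨h, hh⟩ := hg.exists_fourier_eq hβ
  obtain ⟨C, hC, hCψ⟩ := hψ.exists_norm_fourier_le hβ hγ hδ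
  obtain ⟨K, hKtop, hK⟩ := exists_tsum_enorm_fourierCoeff_sq_le hc1 hc2
  set ρ : ℝ := (2 : ℝ) ^ (-(α / 2)) with hρ
  have hρ0 : 0 < ρ := by positivity
  have hρ1 : ρ < 1 := Real.rpow_lt_one_of_one_lt_of_neg one_lt_two (by linarith)
  have hm : ∀ j k, AEMeasurable fun ξ : R3 =>
      ‖h ξ‖ₑ ^ 2 * ENNReal.ofReal (shearletWeight (shearFrequency α j k ξ)) := fun j k =>
    ((Lp.aestronglyMeasurable h).enorm.pow_const 2).mul
      (continuous_shearletWeight.comp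
        (continuous_shearFrequency α j k)).measurable.ennreal_ofReal.aemeasurable
  have hsum : ∑' (j : ℕ) (k : ℤ × ℤ), ∫⁻ ξ,
      ‖h ξ‖ₑ ^ 2 * ENNReal.ofReal (shearletWeight (shearFrequency α j k ξ)) ≤
      ENNReal.ofReal (4 / (1 - ρ)) * ∫⁻ ξ, ‖h ξ‖ₑ ^ 2 := by
    simp_rw [← lintegral_tsum (hm _)]
    rw [← lintegral_tsum fun j => AEMeasurable.tsum (hm j),
      ← lintegral_const_mul' _ _ ENNReal.ofReal_ne_top]
    refine lintegral_mono_ae ?_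
    filter_upwards [ae_apply_ne_zero 0] with ξ hξ
    simp_rw [ENNReal.tsum_mul_left]
    rw [mul_comm]
    gcongr
    exact tsum_shearletWeight_le hρ0 hρ1 hξ (fun j => ξ 1 / (2 : ℝ) ^ ((j : ℝ) / 2))
      (fun j => ξ 2 / (2 : ℝ) ^ ((j : ℝ) / 2))
  have hfin : ∫⁻ ξ, ‖h ξ‖ₑ ^ 2 ≠ ∞ := by
    have h1 := (Lp.memLp h).eLpNorm_lt_top
    rw [eLpNorm_lt_top_iff_lintegral_rpow_enorm_lt_top (by norm_num) (by norm_num)] at h1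
    simpa using h1.ne
  refine ne_top_of_le_ne_top (b := K * ENNReal.ofReal (C ^ 2) *
    (ENNReal.ofReal (4 / (1 - ρ)) * ∫⁻ ξ, ‖h ξ‖ₑ ^ 2)) (ENNReal.mul_ne_top
    (ENNReal.mul_ne_top hKtop ENNReal.ofReal_ne_top)
    (ENNReal.mul_ne_top ENNReal.ofReal_ne_top hfin)) ?_
  rw [ENNReal.tsum_prod (f := fun (j : ℕ) (q : (ℤ × ℤ) × (Fin 3 → ℤ)) =>
    ENNReal.ofReal ((2 : ℝ) ^ (j * α * β)) *
      ‖∫ x : R3, g x * (starRingEnd ℂ) (shearlet α c ψ j q.1 q.2 x)‖ₑ ^ 2)]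
  have hj : ∀ j : ℕ, ∑' q : (ℤ × ℤ) × (Fin 3 → ℤ), ENNReal.ofReal ((2 : ℝ) ^ (j * α * β)) *
      ‖∫ x : R3, g x * (starRingEnd ℂ) (shearlet α c ψ j q.1 q.2 x)‖ₑ ^ 2 ≤
      K * ENNReal.ofReal (C ^ 2) * ∑' k : ℤ × ℤ, ∫⁻ ξ,
        ‖h ξ‖ₑ ^ 2 * ENNReal.ofReal (shearletWeight (shearFrequency α j k ξ)) := by
    intro j
    rw [ENNReal.tsum_prod (f := fun (k : ℤ × ℤ) (m : Fin 3 → ℤ) =>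
      ENNReal.ofReal ((2 : ℝ) ^ (j * α * β)) *
        ‖∫ x : R3, g x * (starRingEnd ℂ) (shearlet α c ψ j k m x)‖ₑ ^ 2), ← ENNReal.tsum_mul_left]
    refine ENNReal.tsum_le_tsum fun k => ?_
    rw [ENNReal.tsum_mul_left]
    exact tsum_shearlet_sq_le hK hβ hC hψsupp.integrable hCψ hh j k
  refine (ENNReal.tsum_le_tsum hj).trans ?_
  rw [ENNReal.tsum_mul_left]
  gcongr

/-! ### Counting the nonzero coefficients -/

/-- A nonzero coefficient forces the translate of the support of `ψ` to meet the support of `g`. -/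
theorem exists_mem_of_integral_shearlet_ne_zero {α : ℝ} {c : ℝ × ℝ} {ψ g : L2R3} {K : Set R3}
    (hg : SupportedIn g unitCube) (hψ : SupportedIn ψ K) {j : ℕ} {k : ℤ × ℤ} {m : Fin 3 → ℤ}
    (h : ∫ x : R3, g x * (starRingEnd ℂ) (shearlet α c ψ j k m x) ≠ 0) :
    ∃ x ∈ unitCube, (WithLp.toLp 2 ((shearMatrix k * scalingMatrix α j) *ᵥ x.ofLp) -
      latticePoint c m : R3) ∈ K := by
  by_contra! hne
  refine h (integral_eq_zero_of_ae ?_)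
  have hM : (shearMatrix k * scalingMatrix α j).det ≠ 0 := by
    rw [det_shear_mul_scaling]; positivity
  filter_upwards [hg, (quasiMeasurePreserving_mulVec_sub hM (latticePoint c m)).ae hψ] with x h1 h2
  by_cases hx : x ∈ unitCube
  · simp [shearlet, h2 (hne x hx)]
  · simp [h1 hx]

theorem SupportedIn.mono {f : L2R3} {K L : Set R3} (hf : SupportedIn f K) (h : K ⊆ L) :
    SupportedIn f L := by
  filter_upwards [hf] with x hx hL using hx fun hK => hL (h hK)

theorem abs_int_le_of_abs_sub_mul_le {c y R B : ℝ} {n : ℤ} (hc : 0 < c) (h : |y - c * n| ≤ R)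
    (hy : |y| + R ≤ B * c) : |n| ≤ ⌊B⌋ := by
  rw [Int.le_floor, Int.cast_abs]
  have h1 : c * |(n : ℝ)| ≤ |y| + R := by
    have h2 : c * |(n : ℝ)| = |c * n| := by rw [abs_mul, abs_of_pos hc]
    rw [h2]
    calc |c * (n : ℝ)| = |y - (y - c * n)| := by congr 1; ring
      _ ≤ |y| + |y - c * n| := abs_sub _ _
      _ ≤ _ := by gcongr
  nlinarith

theorem abs_le_of_integral_shearlet_ne_zero {α R : ℝ} {c : ℝ × ℝ} {ψ g : L2R3}
    (hα : 1 < α) (hc1 : 0 < c.1) (hc2 : 0 < c.2) (hR : 0 ≤ R)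
    (hg : SupportedIn g unitCube) (hψ : SupportedIn ψ (Metric.closedBall 0 R)) {j : ℕ}
    {k : ℤ × ℤ} {m : Fin 3 → ℤ}
    (hk : |k.1| ≤ ⌈(2 : ℝ) ^ (j * (α - 1) / 2)⌉ ∧ |k.2| ≤ ⌈(2 : ℝ) ^ (j * (α - 1) / 2)⌉)
    (h : ∫ x : R3, g x * (starRingEnd ℂ) (shearlet α c ψ j k m x) ≠ 0) :
    |m 0| ≤ ⌊(5 + R) / c.1 * (2 : ℝ) ^ (j * α / 2)⌋ ∧
      |m 1| ≤ ⌊(1 + R) / c.2 * (2 : ℝ) ^ ((j : ℝ) / 2)⌋ ∧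
      |m 2| ≤ ⌊(1 + R) / c.2 * (2 : ℝ) ^ ((j : ℝ) / 2)⌋ := by
  obtain ⟨x, hx, hxR⟩ := exists_mem_of_integral_shearlet_ne_zero hg hψ h
  rw [mem_closedBall_zero_iff, shear_mul_scaling_mulVec] at hxR
  set a : ℝ := (2 : ℝ) ^ (j * α / 2) with ha
  set b : ℝ := (2 : ℝ) ^ ((j : ℝ) / 2) with hb
  set s : ℝ := (2 : ℝ) ^ (j * (α - 1) / 2) with hs
  -- Since |k_i| ≤ ⌈s⌉ ≤ 2s, each shear term is at most 2sb = 2a on the cube; the first coordinate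
  -- is thus at most a + 2a + 2a, whence the constant 5.
  have hsb : s * b = a := by
    rw [hs, hb, ha, ← Real.rpow_add two_pos]; congr 1; ring
  have hs1 : 1 ≤ s := Real.one_le_rpow one_le_two (by
    have : 0 ≤ α - 1 := by linarith
    positivity)
  have hb1 : 1 ≤ b := Real.one_le_rpow one_le_two (by positivity)
  have ha1 : 1 ≤ a := by nlinarith
  have hki : ∀ n : ℤ, |n| ≤ ⌈s⌉ → |(n : ℝ)| ≤ 2 * s := by
    intro n hn
    have h1 : ((|n| : ℤ) : ℝ) ≤ (⌈s⌉ : ℝ) := by exact_mod_cast hn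
    rw [Int.cast_abs] at h1
    linarith [Int.ceil_lt_add_one s]
  have hk1 := hki _ hk.1
  have hk2 := hki _ hk.2
  have hxi : ∀ i, |x i| ≤ 1 := fun i => abs_le.2 ⟨by linarith [(hx i).1], (hx i).2⟩
  have hcoord := fun i => (PiLp.norm_apply_le _ i).trans hxR
  have e0 := hcoord 0
  have e1 := hcoord 1
  have e2 := hcoord 2
  simp [latticePoint, latticeMatrix, dotProduct, Fin.sum_univ_three] at e0 e1 e2
  have hsmall : ∀ i, |b * x i| + R ≤ (1 + R) / c.2 * b * c.2 := by
    intro i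
    have h1 : |b * x i| ≤ b := by
      rw [abs_mul, abs_of_nonneg (by linarith)]; nlinarith [hxi i]
    have h2 : (1 + R) / c.2 * b * c.2 = (1 + R) * b := by field_simp
    rw [h2]; nlinarith
  refine ⟨abs_int_le_of_abs_sub_mul_le hc1 e0 ?_, abs_int_le_of_abs_sub_mul_le hc2 e1 (hsmall 1),
    abs_int_le_of_abs_sub_mul_le hc2 e2 (hsmall 2)⟩
  have h2 : (5 + R) / c.1 * a * c.1 = (5 + R) * a := by field_simp
  have h3 : |a * x 0| ≤ a := by
    rw [abs_mul, abs_of_nonneg (by linarith)]; nlinarith [hxi 0]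
  have h4 : ∀ (n : ℤ) (i : Fin 3), |(n : ℝ)| ≤ 2 * s → |(n : ℝ) * b * x i| ≤ 2 * a := by
    intro n i hn
    rw [abs_mul, abs_mul, abs_of_nonneg (by linarith : (0 : ℝ) ≤ b)]
    calc |(n : ℝ)| * b * |x i| ≤ 2 * s * b * 1 := by
          gcongr
          exact hxi i
      _ = 2 * a := by rw [← hsb]; ring
  rw [h2]
  have h5 := abs_add_three (a * x 0) (k.1 * b * x 1) (k.2 * b * x 2)
  have h6 := h4 _ 1 hk1
  have h7 := h4 _ 2 hk2
  nlinarith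

theorem card_Icc_neg_floor_le {D y : ℝ} (hD : 0 ≤ D) (hy : 1 ≤ y) :
    ((Finset.Icc (-⌊D * y⌋) ⌊D * y⌋).card : ℝ) ≤ (2 * D + 1) * y := by
  have h0 : 0 ≤ ⌊D * y⌋ := Int.floor_nonneg.2 (by positivity)
  have h1 : ((Finset.Icc (-⌊D * y⌋) ⌊D * y⌋).card : ℝ) = 2 * (⌊D * y⌋ : ℝ) + 1 := by
    rw [Int.card_Icc]
    have : (((⌊D * y⌋ + 1 - -⌊D * y⌋).toNat : ℤ) : ℝ) = ((⌊D * y⌋ + 1 - -⌊D * y⌋ : ℤ) : ℝ) := by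
      rw [Int.toNat_of_nonneg (by omega)]
    rw [← Int.cast_natCast, this]
    push_cast; ring
  have h2 := Int.floor_le (D * y)
  rw [h1]
  nlinarith

theorem card_Icc_neg_ceil_le {y : ℝ} (hy : 1 ≤ y) :
    ((Finset.Icc (-⌈y⌉) ⌈y⌉).card : ℝ) ≤ 5 * y := by
  have h0 : 0 ≤ ⌈y⌉ := Int.ceil_nonneg (by linarith)
  have h1 : ((Finset.Icc (-⌈y⌉) ⌈y⌉).card : ℝ) = 2 * (⌈y⌉ : ℝ) + 1 := by
    rw [Int.card_Icc]
    have : (((⌈y⌉ + 1 - -⌈y⌉).toNat : ℤ) : ℝ) = ((⌈y⌉ + 1 - -⌈y⌉ : ℤ) : ℝ) := by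
      rw [Int.toNat_of_nonneg (by omega)]
    rw [← Int.cast_natCast, this]
    push_cast; ring
  have h2 := Int.ceil_lt_add_one y
  rw [h1]
  linarith

/-- Up to scale `J` only `O(2^{3αJ/2})` shearlet coefficients are nonzero. -/
theorem exists_finset_card_le_shearletCoeff_eq_zero {α : ℝ} {c : ℝ × ℝ} {ψ g : L2R3}
    (hα : 1 < α) (hc1 : 0 < c.1) (hc2 : 0 < c.2) (hg : SupportedIn g unitCube)
    (hψ : CompactlySupported ψ) :
    ∃ E : ℝ, 0 < E ∧ ∀ J : ℕ, ∃ F : Finset (ShearletIndex α),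
      (F.card : ℝ) ≤ E * ((2 : ℝ) ^ (3 * α / 2)) ^ J ∧
      ∀ l : ShearletIndex α, l ∉ F → l.1.1 < J → shearletCoeff α c ψ g l = 0 := by
  classical
  obtain ⟨K, hK, hKs⟩ := hψ
  obtain ⟨R, hR, hKR⟩ := hK.isBounded.subset_closedBall_lt 0 0
  have hKs' := hKs.mono hKR
  set D1 : ℝ := (5 + R) / c.1 with hD1
  set D2 : ℝ := (1 + R) / c.2 with hD2
  have hD1' : 0 ≤ D1 := by positivity
  have hD2' : 0 ≤ D2 := by positivity
  set E : ℝ := 25 * ((2 * D1 + 1) * ((2 * D2 + 1) * (2 * D2 + 1))) with hE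
  have hE0 : 0 < E := by positivity
  refine ⟨E, hE0, fun J => ?_⟩
  set I : ℤ → Finset ℤ := fun n => Finset.Icc (-n) n with hI
  set G : ℕ → Finset (ℕ × (ℤ × ℤ) × (Fin 3 → ℤ)) := fun j =>
    {j} ×ˢ ((I ⌈(2 : ℝ) ^ (j * (α - 1) / 2)⌉ ×ˢ I ⌈(2 : ℝ) ^ (j * (α - 1) / 2)⌉) ×ˢ
      Fintype.piFinset ![I ⌊D1 * (2 : ℝ) ^ (j * α / 2)⌋, I ⌊D2 * (2 : ℝ) ^ ((j : ℝ) / 2)⌋,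
        I ⌊D2 * (2 : ℝ) ^ ((j : ℝ) / 2)⌋]) with hG
  have hGcard : ∀ j, ((G j).card : ℝ) ≤ E * ((2 : ℝ) ^ (3 * α / 2)) ^ j := by
    intro j
    have hα' : 0 ≤ α - 1 := by linarith
    have hs1 : 1 ≤ (2 : ℝ) ^ (j * (α - 1) / 2) := Real.one_le_rpow one_le_two (by positivity)
    have ha1 : 1 ≤ (2 : ℝ) ^ (j * α / 2) := Real.one_le_rpow one_le_two (by positivity)
    have hb1 : 1 ≤ (2 : ℝ) ^ ((j : ℝ) / 2) := Real.one_le_rpow one_le_two (by positivity)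
    have c1 := card_Icc_neg_ceil_le hs1
    have c2 := card_Icc_neg_floor_le hD1' ha1
    have c3 := card_Icc_neg_floor_le hD2' hb1
    -- Exponents per unit of j: two shears give α - 1, the translations α/2 + 1, in total 3α/2.
    have e : (2 : ℝ) ^ (j * (α - 1) / 2) * (2 : ℝ) ^ (j * (α - 1) / 2) * ((2 : ℝ) ^ (j * α / 2) *
        ((2 : ℝ) ^ ((j : ℝ) / 2) * (2 : ℝ) ^ ((j : ℝ) / 2))) = ((2 : ℝ) ^ (3 * α / 2)) ^ j := by
      rw [← Real.rpow_add two_pos, ← Real.rpow_add two_pos, ← Real.rpow_add two_pos,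
        ← Real.rpow_add two_pos, ← Real.rpow_mul_natCast two_pos.le]
      congr 1; ring
    rw [hG]
    simp only [Finset.card_product, Finset.card_singleton, one_mul, Fintype.card_piFinset,
      Fin.prod_univ_three, Matrix.cons_val_zero, Matrix.cons_val_one, Matrix.cons_val]
    push_cast
    calc _ ≤ (5 * (2 : ℝ) ^ (j * (α - 1) / 2)) * (5 * (2 : ℝ) ^ (j * (α - 1) / 2)) *
          ((2 * D1 + 1) * (2 : ℝ) ^ (j * α / 2) * ((2 * D2 + 1) * (2 : ℝ) ^ ((j : ℝ) / 2)) *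
            ((2 * D2 + 1) * (2 : ℝ) ^ ((j : ℝ) / 2))) := by gcongr
      _ = E * ((2 : ℝ) ^ (j * (α - 1) / 2) * (2 : ℝ) ^ (j * (α - 1) / 2) *
          ((2 : ℝ) ^ (j * α / 2) * ((2 : ℝ) ^ ((j : ℝ) / 2) * (2 : ℝ) ^ ((j : ℝ) / 2)))) := by
          rw [hE]; ring
      _ = _ := by rw [e]
  -- A ratio of at least 2 lets the sum over lower scales be absorbed with the same constant `E`.
  have hP : 2 ≤ (2 : ℝ) ^ (3 * α / 2) := by
    calc (2 : ℝ) = 2 ^ (1 : ℝ) := (Real.rpow_one 2).symm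
      _ ≤ _ := Real.rpow_le_rpow_of_exponent_le one_le_two (by linarith)
  have hsum : ∀ n : ℕ, (((Finset.range n).biUnion G).card : ℝ) ≤
      E * ((2 : ℝ) ^ (3 * α / 2)) ^ n := by
    intro n
    induction n with
    | zero => simp [hE0.le]
    | succ n ih =>
      rw [Finset.range_add_one, Finset.biUnion_insert]
      have h1 : ((G n ∪ (Finset.range n).biUnion G).card : ℝ) ≤
          (G n).card + ((Finset.range n).biUnion G).card := by
        exact_mod_cast Finset.card_union_le _ _
      have h2 := hGcard n
      have h3 : 0 ≤ E * ((2 : ℝ) ^ (3 * α / 2)) ^ n := by positivity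
      rw [pow_succ]
      nlinarith
  have hinj : Function.Injective fun l : ShearletIndex α => l.1 := Subtype.val_injective
  refine ⟨((Finset.range J).biUnion G).preimage (fun l => l.1) hinj.injOn, ?_, ?_⟩
  · refine le_trans ?_ (hsum J)
    exact_mod_cast Finset.card_le_card_of_injOn (fun l : ShearletIndex α => l.1)
      (fun l hl => Finset.mem_preimage.1 hl) hinj.injOn
  · intro l hl hlJ
    by_contra hne
    refine hl ?_
    obtain ⟨h0, h1, h2⟩ := abs_le_of_integral_shearlet_ne_zero hα hc1 hc2 hR.le hg hKs' l.2 hne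
    refine Finset.mem_preimage.2 (Finset.mem_biUnion.2 ?_)
    refine ⟨l.1.1, Finset.mem_range.2 hlJ, ?_⟩
    simp only [hG, hI, Finset.mem_product, Finset.mem_singleton, Fintype.mem_piFinset,
      Finset.mem_Icc, true_and]
    refine ⟨⟨abs_le.1 l.2.1, abs_le.1 l.2.2⟩, fun i => ?_⟩
    fin_cases i
    · exact Finset.mem_Icc.2 (abs_le.1 h0)
    · exact Finset.mem_Icc.2 (abs_le.1 h1)
    · exact Finset.mem_Icc.2 (abs_le.1 h2)

/-! ### Choice of the scale and conclusion -/

/-- For N ≥ E, take the largest J with E P^J ≤ N, so that N < E P^{J+1}. For N < E, J = 0 still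
satisfies the second bound, and no coefficient has to be selected. -/
theorem exists_scale_of_count {E P θ : ℝ} (hE : 0 < E) (hP : 1 < P) (hθ : 0 ≤ θ) {N : ℕ}
    (hN : 1 ≤ N) :
    ∃ J : ℕ, (J = 0 ∨ E * P ^ J ≤ N) ∧ (P ^ J) ^ (-θ) ≤ (E * P) ^ θ * (N : ℝ) ^ (-θ) := by
  have hP0 : 0 < P := by linarith
  have hN0 : (0 : ℝ) < N := by exact_mod_cast hN
  have key : ∀ J : ℕ, (N : ℝ) ≤ E * P ^ (J + 1) →
      (P ^ J) ^ (-θ) ≤ (E * P) ^ θ * (N : ℝ) ^ (-θ) := by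
    intro J h
    have h1 : (N : ℝ) ^ θ ≤ (E * P) ^ θ * (P ^ J) ^ θ := by
      rw [← Real.mul_rpow (by positivity) (by positivity)]
      refine Real.rpow_le_rpow hN0.le (h.trans_eq ?_) hθ
      ring
    rw [Real.rpow_neg (by positivity), Real.rpow_neg hN0.le, ← div_eq_mul_inv,
      le_div_iff₀ (by positivity), ← div_eq_inv_mul, div_le_iff₀ (by positivity)]
    exact h1
  rcases lt_or_ge (N : ℝ) E with h | h
  · refine ⟨0, Or.inl rfl, key 0 ?_⟩
    rw [zero_add, pow_one]
    nlinarith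
  · obtain ⟨J, h1, h2⟩ := exists_nat_pow_near ((one_le_div hE).2 h) hP
    refine ⟨J, Or.inr ((le_div_iff₀' hE).1 h1), key J ?_⟩
    exact ((div_lt_iff₀' hE).1 h2).le

theorem mainTheorem11 (α β δ γ : ℝ) (c : ℝ × ℝ) (ψ g : L2R3)
    (hα : 1 < α) (hα2 : α ≤ 2) (hc1 : 0 < c.1) (hc2 : 0 < c.2) (hβ : 0 ≤ β)
    (hg : InSobolev β g) (hgsupp : SupportedIn g unitCube)
    (hψsupp : CompactlySupported ψ) (hψ : IsFeasible δ γ ψ)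
    (hδ : 2 * γ + β < δ) (hγ : 3 < γ) :
    ∃ C : ℝ, ∀ N : ℕ, 1 ≤ N →
      ∑' n : Set.Ioi N, sortedAbs (shearletCoeff α c ψ g) n ^ 2 ≤
        ENNReal.ofReal (C * (N : ℝ) ^ (-(2 * β / 3))) := by
  have hα0 : 0 < α := by linarith
  have hfin := tsum_weighted_shearlet_sq_ne_top hα0 hc1 hc2 hβ hg hψsupp hψ
    (by linarith) hγ.le
  set Φ : ℕ × (ℤ × ℤ) × (Fin 3 → ℤ) → ℝ≥0∞ := fun p =>
    ENNReal.ofReal ((2 : ℝ) ^ (p.1 * α * β)) *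
      ‖∫ x : R3, g x * (starRingEnd ℂ) (shearlet α c ψ p.1 p.2.1 p.2.2 x)‖ₑ ^ 2 with hΦ
  obtain ⟨E, hE, hF⟩ := exists_finset_card_le_shearletCoeff_eq_zero hα hc1 hc2 hgsupp hψsupp
  set P : ℝ := (2 : ℝ) ^ (3 * α / 2) with hP
  have hP1 : 1 < P := Real.one_lt_rpow one_lt_two (by linarith)
  have : Countable (ShearletIndex α) := by unfold ShearletIndex; infer_instance
  refine ⟨(∑' p, Φ p).toReal * (E * P) ^ (2 * β / 3), fun N hN => ?_⟩
  obtain ⟨J, hJ, hJN⟩ := exists_scale_of_count hE hP1 (by positivity : 0 ≤ 2 * β / 3) hN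
  obtain ⟨F, hFc, hF0⟩ : ∃ F : Finset (ShearletIndex α), F.card ≤ N ∧
      ∀ l : ShearletIndex α, l ∉ F → l.1.1 < J → shearletCoeff α c ψ g l = 0 := by
    rcases hJ with rfl | hJ
    · exact ⟨∅, by simp, fun l _ hl => absurd hl (Nat.not_lt_zero _)⟩
    · obtain ⟨F, h1, h2⟩ := hF J
      exact ⟨F, by exact_mod_cast h1.trans hJ, h2⟩
  -- As P = 2^{3α/2}, the power -2β/3 of P^J is 2^{-Jαβ}: here the rate N^{-2β/3} arises.
  have hPJ : (P ^ J) ^ (-(2 * β / 3)) * (2 : ℝ) ^ (J * α * β) = 1 := by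
    rw [hP, ← Real.rpow_mul_natCast two_pos.le, ← Real.rpow_mul two_pos.le,
      ← Real.rpow_add two_pos]
    convert Real.rpow_zero (2 : ℝ) using 2
    ring
  have hterm : ∀ l : {l : ShearletIndex α // l ∉ F}, ‖shearletCoeff α c ψ g l.1‖ₑ ^ 2 ≤
      ENNReal.ofReal ((P ^ J) ^ (-(2 * β / 3))) * Φ l.1.1 := by
    intro l
    rcases lt_or_ge l.1.1.1 J with hl | hl
    · rw [hF0 l.1 l.2 hl]; simp
    · have h1 : 1 ≤ (P ^ J) ^ (-(2 * β / 3)) * (2 : ℝ) ^ (l.1.1.1 * α * β) := by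
        refine hPJ.symm.le.trans ?_
        gcongr
        exact one_le_two
      rw [hΦ]
      simp only []
      rw [← mul_assoc, ← ENNReal.ofReal_mul (by positivity)]
      exact le_mul_of_one_le_left zero_le (ENNReal.one_le_ofReal.2 h1)
  calc _ ≤ ∑' l : {l : ShearletIndex α // l ∉ F}, ‖shearletCoeff α c ψ g l.1‖ₑ ^ 2 :=
        tsum_sortedAbs_sq_le _ F hFc
    _ ≤ ∑' l : {l : ShearletIndex α // l ∉ F},
          ENNReal.ofReal ((P ^ J) ^ (-(2 * β / 3))) * Φ l.1.1 := ENNReal.tsum_le_tsum hterm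
    _ ≤ ENNReal.ofReal ((P ^ J) ^ (-(2 * β / 3))) * ∑' p, Φ p := by
        rw [ENNReal.tsum_mul_left]
        gcongr
        exact ENNReal.tsum_comp_le_tsum_of_injective
          (Subtype.val_injective.comp Subtype.val_injective) Φ
    _ = ENNReal.ofReal ((P ^ J) ^ (-(2 * β / 3)) * (∑' p, Φ p).toReal) := by
        rw [ENNReal.ofReal_mul (by positivity), ENNReal.ofReal_toReal hfin]
    _ ≤ _ := by
        refine ENNReal.ofReal_le_ofReal ?_
        calc _ ≤ ((E * P) ^ (2 * β / 3) * (N : ℝ) ^ (-(2 * β / 3))) * (∑' p, Φ p).toReal := by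
              gcongr
          _ = _ := by ring
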